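/- Notation. Write $z\in\mathbb C^N$ as a row vector. Let $\mathcal D_N$ be the set of complex symmetric $N\times N$ matrices $A$ with $A^*A<I$, and put $Q_A(z)=zAz^T$. For $A\in\mathcal D_N$, $w\in S^{2N-1}\subset\mathbb C^N$ and an integer $k\ge 1$ let $$\psi_{A,w}(z)=e^{kQ_A(z-w)/2}\,e^{kz\overline w^T}\,e^{-k|w|^2/2}\,e^{-k|z|^2/2}\quad(z\in\mathbb C^N),$$ $$\Psi_{A,w}(z)=\frac1{2\pi}\int_0^{2\pi}e^{-ikt}\,\psi_{A,w}(e^{it}z)\,dt\quad(z\in S^{2N-1}).$$ For $N=2$ let $|n\rangle=\frac1\pi\sqrt{\frac{k+1}2}\sqrt{\binom kn}\,z_1^n z_2^{k-n}$, $0\le n\le k$, as functions on $S^3$, and let $\|\cdot\|$ be the norm of $L^2(S^3)$ with respect to the surface measure. **Proposition 1.6.** (1) Let $\mu\in\mathbb C$ with $|\mu|<1$, and let $[\mu]=\begin{pmatrix}0&0\\0&\mu\end{pmatrix}$. Then for every $k\ge1$, on $S^3$, $$\Psi_{[\mu],(1,0)}=\pi k^k e^{-k}\sqrt{\frac2{(k+1)!}}\sum_{0\le\ell\le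 k/2}\Bigl(\frac1{2k}\Bigr)^{\ell}\frac1{\sqrt{(k-2\ell)!}}\sqrt{\binom{2\ell}{\ell}}\;\mu^\ell\,|k-2\ell\rangle .$$ (2) Let $A=\begin{pmatrix}a&c\\c&b\end{pmatrix}\in\mathcal D_2$ and $w=(1,0)$. Then $\operatorname{Re}(1+a)>0$, and if $\mu=b-\frac{c^2}{1+a}$, then $|\mu|<1$. This $\mu$ is the parameter of the symbol of $\Psi_{A,w}$: for all $\zeta\in\mathbb C$, with $\eta=(0,\zeta)$, $$\frac1{2\pi}e^{-|\eta|^2/2}\int_{-\infty}^\infty e^{Q_A(isw+\eta)/2}e^{-s^2/2}\,ds=\frac1{\sqrt{2\pi}}\frac1{\sqrt{1+a}}\,e^{\mu\zeta^2/2}e^{-|\zeta|^2/2},$$ where the square root is the principal one. Moreover $$\Psi_{A,w}=\frac1{\sqrt{1+a}}\,\Psi_{[\mu],(1,0)}\bigl(1+O(k^{-1/2})\bigr)\quad\text{in norm},$$ that is, $\Psi_{A,w}$ and $\Psi_{[\mu],(1,0)}$ lie in $L^2(S^3)$ and there is a constant $C$, depending only on $A$, such that for all $k\ge1$ $$\bigl\|\Psi_{A,w}-(1+a)^{-1/2}\,\Psi_{[\mu],(1,0)}\bigr\|\le\frac{C}{\sqrt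 k}\,\bigl\|\Psi_{[\mu],(1,0)}\bigr\| .$$ -/

import Mathlib

open MeasureTheory

namespace ReducedGaussian

/-- The generalized unit disk: complex symmetric `N × N` matrices `A` with `A* A < I`. -/
def Disk (N : ℕ) : Set (Matrix (Fin N) (Fin N) ℂ) :=
  open scoped ComplexOrder in
  {A | A.IsSymm ∧ (1 - A.conjTranspose * A).PosDef}

/-- The quadratic form `Q_A(z) = z A zᵀ`. -/
noncomputable def quadForm {N : ℕ} (A : Matrix (Fin N) (Fin N) ℂ)
    (z : EuclideanSpace ℂ (Fin N)) : ℂ :=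
  ∑ i, ∑ j, z i * A i j * z j

/-- The Gaussian coherent state
`ψ_{A,w}(z) = exp(k Q_A(z - w)/2) exp(k z w̄ᵀ) exp(-k |w|²/2) exp(-k |z|²/2)` on `ℂ^N`. -/
noncomputable def gaussianState {N : ℕ} (k : ℕ) (A : Matrix (Fin N) (Fin N) ℂ)
    (w z : EuclideanSpace ℂ (Fin N)) : ℂ :=
  Complex.exp (k * quadForm A (z - w) / 2) *
    Complex.exp (k * ∑ i, z i * (starRingEnd ℂ) (w i)) *
    Complex.exp (-k * (‖w‖ : ℂ) ^ 2 / 2) * Complex.exp (-k * (‖z‖ : ℂ) ^ 2 / 2)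

/-- The unit sphere `S^{2N-1}` in `ℂ^N`. -/
abbrev USphere (N : ℕ) : Type := Metric.sphere (0 : EuclideanSpace ℂ (Fin N)) 1

/-- The (non-normalized) surface measure of `S^{2N-1}`, of total mass `2 π^N / (N-1)!`. -/
noncomputable def surface (N : ℕ) : Measure (USphere N) :=
  (volume : Measure (EuclideanSpace ℂ (Fin N))).toSphere

/-- The quantum reduction operator
`R_k(ψ)(z) = (2π)⁻¹ ∫_0^{2π} e^{-ikt} ψ(e^{it} z) dt`, for `z` in the unit sphere. -/
noncomputable def reduction {N : ℕ} (k : ℕ) (ψ : EuclideanSpace ℂ (Fin N) → ℂ)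
    (z : USphere N) : ℂ :=
  1 / (2 * (Real.pi : ℂ)) * ∫ t in (0 : ℝ)..(2 * Real.pi),
    Complex.exp (-(Complex.I * k * t)) *
      ψ (Complex.exp (Complex.I * t) • (z : EuclideanSpace ℂ (Fin N)))

/-- The reduced Gaussian state `Ψ_{A,w} = R_k(ψ_{A,w})`. -/
noncomputable def reducedState {N : ℕ} (k : ℕ) (A : Matrix (Fin N) (Fin N) ℂ)
    (w : USphere N) : USphere N → ℂ :=
  reduction k (gaussianState k A (w : EuclideanSpace ℂ (Fin N)))

/-- The standard basis functions
`|n⟩ = π⁻¹ √((k+1)/2) √(k choose n) z₁ⁿ z₂^{k-n}`, `0 ≤ n ≤ k`, on `S³`. -/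
noncomputable def ket (k n : ℕ) (z : USphere 2) : ℂ :=
  ((1 / Real.pi * √(((k : ℝ) + 1) / 2) * √((k.choose n : ℕ) : ℝ) : ℝ) : ℂ) *
    (z : EuclideanSpace ℂ (Fin 2)) 0 ^ n * (z : EuclideanSpace ℂ (Fin 2)) 1 ^ (k - n)

/-- The point `(1, 0)` of `S³`. -/
noncomputable def north : USphere 2 :=
  ⟨EuclideanSpace.single 0 1, by simp⟩

/-- The symbol of `Ψ_{A,w}`, a function of `η` in the orthogonal complement of `ℂ w`:
`σ_A(η) = (2π)⁻¹ e^{-|η|²/2} ∫_ℝ e^{Q_A(i s w + η)/2} e^{-s²/2} ds`. -/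
noncomputable def gaussianSymbol {N : ℕ} (A : Matrix (Fin N) (Fin N) ℂ)
    (w : USphere N) (η : EuclideanSpace ℂ (Fin N)) : ℂ :=
  1 / (2 * (Real.pi : ℂ)) * Complex.exp (-(‖η‖ : ℂ) ^ 2 / 2) *
    ∫ s : ℝ, Complex.exp
        (quadForm A ((Complex.I * s) • (w : EuclideanSpace ℂ (Fin N)) + η) / 2) *
      Complex.exp (-(s : ℂ) ^ 2 / 2)

end ReducedGaussian

/-! Up to a phase, `ψ_{A,w}` is the translate by `w` of `ψ_{A,0} = exp (k (Q_A - |·|²) / 2)`, whose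
exponent is coercive because `A* A < I`. Laplace's method along the orbit `t ↦ e^{it} z` therefore
gives `Ψ_{A,w}(z) = e^{iθ} k^{-1/2} σ_A(√k η) + O(k⁻¹ e^{-κk|η|²})`, where `η` is the component of
the point of the orbit nearest to `w` that is orthogonal to `w`, and `θ` does not depend on `A`.
Hence states with proportional symbols are proportional up to `O(k^{-3/2})` in `L²`, whereas
`‖Ψ_{[μ]}‖ ≥ c / k`: its explicit expansion is of order `k^{-1/2}` on the cap `|z₂|² ≤ 1 / (4k)`,
whose measure is of order `1 / k`. -/

namespace ReducedGaussian

open scoped ComplexConjugate Matrix Real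

section QuadForm

variable {N : ℕ}

theorem quadForm_smul (A : Matrix (Fin N) (Fin N) ℂ) (c : ℂ) (z : EuclideanSpace ℂ (Fin N)) :
    quadForm A (c • z) = c ^ 2 * quadForm A z := by
  simp only [quadForm, PiLp.smul_apply, smul_eq_mul, Finset.mul_sum]
  exact Finset.sum_congr rfl fun i _ => Finset.sum_congr rfl fun j _ => by ring

theorem quadForm_eq_dotProduct (A : Matrix (Fin N) (Fin N) ℂ) (z : EuclideanSpace ℂ (Fin N)) :
    quadForm A z = z ⬝ᵥ A *ᵥ z := by
  simp only [quadForm, dotProduct, Matrix.mulVec, Finset.mul_sum, mul_assoc]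

theorem continuous_quadForm (A : Matrix (Fin N) (Fin N) ℂ) : Continuous (quadForm A) := by
  unfold quadForm
  fun_prop

theorem norm_quadForm_sub_le (A : Matrix (Fin N) (Fin N) ℂ) (u v : EuclideanSpace ℂ (Fin N)) :
    ‖quadForm A u - quadForm A v‖ ≤ (∑ i, ∑ j, ‖A i j‖) * ((‖u‖ + ‖v‖) * ‖u - v‖) := by
  have hterm (i j : Fin N) :
      ‖u i * A i j * u j - v i * A i j * v j‖ ≤ ‖A i j‖ * ((‖u‖ + ‖v‖) * ‖u - v‖) := by
    calc ‖u i * A i j * u j - v i * A i j * v j‖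
        = ‖A i j * (u i * (u - v) j + (u - v) i * v j)‖ := by
          simp only [PiLp.sub_apply]; ring_nf
      _ ≤ ‖A i j‖ * (‖u i‖ * ‖(u - v) j‖ + ‖(u - v) i‖ * ‖v j‖) := by
          rw [norm_mul]
          gcongr
          exact (norm_add_le _ _).trans_eq (by rw [norm_mul, norm_mul])
      _ ≤ ‖A i j‖ * (‖u‖ * ‖u - v‖ + ‖u - v‖ * ‖v‖) := by
          gcongr <;> exact PiLp.norm_apply_le _ _
      _ = ‖A i j‖ * ((‖u‖ + ‖v‖) * ‖u - v‖) := by ring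
  simp only [quadForm, ← Finset.sum_sub_distrib, Finset.sum_mul]
  exact (norm_sum_le _ _).trans <| Finset.sum_le_sum fun i _ =>
    (norm_sum_le _ _).trans <| Finset.sum_le_sum fun j _ => hterm i j

theorem norm_mulVec_lt_of_mem_disk {A : Matrix (Fin N) (Fin N) ℂ} (hA : A ∈ Disk N)
    {z : EuclideanSpace ℂ (Fin N)} (hz : z ≠ 0) : ‖WithLp.toLp 2 (A *ᵥ z)‖ < ‖z‖ := by
  have hpos := open scoped ComplexOrder in
    (Complex.lt_def.mp (hA.2.dotProduct_mulVec_pos (x := z) (by simpa using hz))).1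
  have hdiff : star ⇑z ⬝ᵥ (1 - Aᴴ * A) *ᵥ z =
      ((‖z‖ ^ 2 - ‖WithLp.toLp 2 (A *ᵥ z)‖ ^ 2 : ℝ) : ℂ) := by
    push_cast
    rw [← Complex.coe_algebraMap, ← inner_self_eq_norm_sq_to_K (𝕜 := ℂ),
      ← inner_self_eq_norm_sq_to_K (𝕜 := ℂ), EuclideanSpace.inner_eq_star_dotProduct,
      EuclideanSpace.inner_eq_star_dotProduct, Matrix.sub_mulVec, Matrix.one_mulVec,
      dotProduct_sub, ← Matrix.mulVec_mulVec, Matrix.dotProduct_mulVec, ← Matrix.star_mulVec,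
      dotProduct_comm (star _), dotProduct_comm (star _)]
  rw [hdiff, Complex.zero_re, Complex.ofReal_re, sub_pos] at hpos
  exact lt_of_pow_lt_pow_left₀ 2 (norm_nonneg z) hpos

theorem norm_quadForm_lt_of_mem_disk {A : Matrix (Fin N) (Fin N) ℂ} (hA : A ∈ Disk N)
    {z : EuclideanSpace ℂ (Fin N)} (hz : z ≠ 0) : ‖quadForm A z‖ < ‖z‖ ^ 2 := by
  have hcs : ‖quadForm A z‖ ≤ ‖WithLp.toLp 2 (star ⇑z)‖ * ‖WithLp.toLp 2 (A *ᵥ z)‖ := by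
    have := norm_inner_le_norm (𝕜 := ℂ) (WithLp.toLp 2 (star ⇑z)) (WithLp.toLp 2 (A *ᵥ z))
    rwa [EuclideanSpace.inner_toLp_toLp, star_star, dotProduct_comm,
      ← quadForm_eq_dotProduct] at this
  have hstar : ‖WithLp.toLp 2 (star ⇑z)‖ = ‖z‖ := by simp [EuclideanSpace.norm_eq]
  rw [hstar] at hcs
  exact hcs.trans_lt <| (mul_lt_mul_of_pos_left (norm_mulVec_lt_of_mem_disk hA hz)
    (norm_pos_iff.mpr hz)).trans_eq (sq _).symm

theorem exists_norm_quadForm_le_of_mem_disk {A : Matrix (Fin N) (Fin N) ℂ} (hA : A ∈ Disk N) :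
    ∃ δ > 0, ∀ z, ‖quadForm A z‖ ≤ (1 - δ) * ‖z‖ ^ 2 := by
  obtain ⟨δ, hδ, hle⟩ := (isCompact_sphere (0 : EuclideanSpace ℂ (Fin N)) 1).exists_forall_le'
    (f := fun z => 1 - ‖quadForm A z‖) (a := 0)
    (continuous_const.sub (continuous_quadForm A).norm).continuousOn fun z hz => by
      have hz1 : ‖z‖ = 1 := mem_sphere_zero_iff_norm.mp hz
      have hlt := norm_quadForm_lt_of_mem_disk hA (norm_ne_zero_iff.mp (hz1 ▸ one_ne_zero))
      rw [hz1, one_pow] at hlt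
      exact sub_pos.mpr hlt
  refine ⟨δ, hδ, fun z => ?_⟩
  rcases eq_or_ne z 0 with rfl | hz
  · simp [quadForm]
  have hz' : ‖z‖ ≠ 0 := norm_ne_zero_iff.mpr hz
  have hscale : ‖quadForm A z‖ = ‖z‖ ^ 2 * ‖quadForm A ((‖z‖ : ℂ)⁻¹ • z)‖ := by
    rw [quadForm_smul, norm_mul]
    simp [hz']
  have := hle ((‖z‖ : ℂ)⁻¹ • z) (by simp [norm_smul, hz'])
  rw [hscale, mul_comm]
  gcongr
  linarith

theorem one_add_re_pos_of_mem_disk {a b c : ℂ} (h : !![a, c; c, b] ∈ Disk 2) :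
    0 < (1 + a).re := by
  have hlt : ‖a‖ < 1 := by
    simpa [quadForm] using
      norm_quadForm_lt_of_mem_disk h (z := EuclideanSpace.single 0 1) (by simp)
  rw [Complex.add_re, Complex.one_re]
  linarith [neg_abs_le a.re, Complex.abs_re_le_norm a]

theorem norm_sub_div_lt_one_of_mem_disk {a b c : ℂ} (h : !![a, c; c, b] ∈ Disk 2) :
    ‖b - c ^ 2 / (1 + a)‖ < 1 := by
  have ha : 1 + a ≠ 0 := fun h0 => by simpa [h0] using one_add_re_pos_of_mem_disk h
  have hlt := norm_mulVec_lt_of_mem_disk h (z := !₂[-(c / (1 + a)), 1])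
    fun h0 => by simpa using congrArg (fun v => v 1) h0
  have hAv : (!![a, c; c, b] : Matrix _ _ ℂ) *ᵥ ![-(c / (1 + a)), 1] =
      ![c / (1 + a), b - c ^ 2 / (1 + a)] := by
    ext i
    fin_cases i <;> simp [Matrix.mulVec, dotProduct] <;> field_simp <;> ring
  simpa [hAv, EuclideanSpace.norm_sq_eq] using pow_lt_pow_left₀ hlt (norm_nonneg _) two_ne_zero

open scoped ComplexOrder in
theorem diagonal_mem_disk {μ : ℂ} (hμ : ‖μ‖ < 1) : !![0, 0; 0, μ] ∈ Disk 2 := by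
  have hdiag : !![0, 0; 0, μ] = Matrix.diagonal ![0, μ] := by
    ext i j; fin_cases i <;> fin_cases j <;> rfl
  rw [hdiag]
  refine ⟨Matrix.isSymm_diagonal _, ?_⟩
  rw [Matrix.diagonal_conjTranspose, Matrix.diagonal_mul_diagonal, ← Matrix.diagonal_one,
    Matrix.diagonal_sub, Matrix.posDef_diagonal_iff, Fin.forall_fin_two]
  have hμ2 : ‖μ‖ ^ 2 < 1 := pow_lt_one₀ (norm_nonneg _) hμ two_ne_zero
  refine ⟨by simp, ?_⟩
  simpa [Complex.conj_mul'] using mod_cast hμ2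

end QuadForm

section Orbit

variable {E : Type*} [NormedAddCommGroup E] [InnerProductSpace ℂ E] {w z : E} {r : ℝ}

theorem norm_sq_smul_add_of_inner_eq_zero (hw : ‖w‖ = 1) {η : E} (hη : inner ℂ w η = 0) (c : ℂ) :
    ‖c • w + η‖ ^ 2 = ‖c‖ ^ 2 + ‖η‖ ^ 2 := by
  have := norm_add_sq_eq_norm_sq_add_norm_sq_of_inner_eq_zero (𝕜 := ℂ) (c • w) η
    (by rw [inner_smul_left, hη, mul_zero])
  simpa only [← sq, norm_smul, hw, mul_one] using this

theorem inner_sub_smul_eq_zero (hw : ‖w‖ = 1) (hzw : inner ℂ w z = r) :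
    inner ℂ w (z - (r : ℂ) • w) = 0 := by
  rw [inner_sub_right, inner_smul_right, inner_self_eq_norm_sq_to_K, hw, hzw]
  simp

theorem norm_sq_sub_smul (hw : ‖w‖ = 1) (hz : ‖z‖ = 1) (hzw : inner ℂ w z = r) :
    ‖z - (r : ℂ) • w‖ ^ 2 = 1 - r ^ 2 := by
  have := norm_sq_smul_add_of_inner_eq_zero hw (inner_sub_smul_eq_zero hw hzw) r
  rw [add_sub_cancel, hz, Complex.norm_real, Real.norm_eq_abs, sq_abs] at this
  linarith

theorem le_one_of_inner_eq_ofReal (hw : ‖w‖ = 1) (hz : ‖z‖ = 1) (hzw : inner ℂ w z = r) :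
    r ≤ 1 := by
  have := norm_inner_le_norm (𝕜 := ℂ) w z
  rw [hzw, hw, hz, one_mul, Complex.norm_real] at this
  exact (le_abs_self r).trans this

theorem norm_sq_exp_smul_sub (hw : ‖w‖ = 1) (hz : ‖z‖ = 1) (hzw : inner ℂ w z = r) (t : ℝ) :
    ‖Complex.exp (Complex.I * t) • z - w‖ ^ 2 = 2 - 2 * r * Real.cos t := by
  have hre : (Complex.exp (Complex.I * t) * r).re = Real.cos t * r := by
    rw [Complex.re_mul_ofReal, mul_comm Complex.I, Complex.exp_ofReal_mul_I_re]
  rw [norm_sub_rev, norm_sub_sq (𝕜 := ℂ), inner_smul_right, hzw, norm_smul,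
    Complex.norm_exp_I_mul_ofReal, hw, hz, RCLike.re_eq_complex_re, hre]
  ring

theorem norm_sq_I_mul_smul_add (hw : ‖w‖ = 1) (hz : ‖z‖ = 1) (hzw : inner ℂ w z = r) (t : ℝ) :
    ‖(Complex.I * t) • w + (z - (r : ℂ) • w)‖ ^ 2 = t ^ 2 + (1 - r ^ 2) := by
  rw [norm_sq_smul_add_of_inner_eq_zero hw (inner_sub_smul_eq_zero hw hzw),
    norm_sq_sub_smul hw hz hzw]
  simp

theorem norm_exp_smul_sub_le (hw : ‖w‖ = 1) (hz : ‖z‖ = 1) (hzw : inner ℂ w z = r) (hr : 0 ≤ r)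
    (t : ℝ) :
    ‖Complex.exp (Complex.I * t) • z - w‖ ≤ 2 * ‖(Complex.I * t) • w + (z - (r : ℂ) • w)‖ := by
  refine le_of_sq_le_sq ?_ (by positivity)
  rw [mul_pow, norm_sq_exp_smul_sub hw hz hzw, norm_sq_I_mul_smul_add hw hz hzw]
  have hr1 := le_one_of_inner_eq_ofReal hw hz hzw
  nlinarith [Real.one_sub_sq_div_two_le_cos (x := t), sq_nonneg t]

theorem sq_norm_I_mul_smul_add_le (hw : ‖w‖ = 1) (hz : ‖z‖ = 1) (hzw : inner ℂ w z = r)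
    (hr : 0 ≤ r) {t : ℝ} (ht : |t| ≤ π) :
    ‖(Complex.I * t) • w + (z - (r : ℂ) • w)‖ ^ 2 ≤
      π ^ 2 * ‖Complex.exp (Complex.I * t) • z - w‖ ^ 2 := by
  rw [norm_sq_exp_smul_sub hw hz hzw, norm_sq_I_mul_smul_add hw hz hzw]
  have hcos : 2 * t ^ 2 ≤ π ^ 2 * (1 - Real.cos t) := by
    have := mul_le_mul_of_nonneg_left (Real.cos_le_one_sub_mul_cos_sq ht) (sq_nonneg π)
    field_simp at this
    linarith
  have hr1 := le_one_of_inner_eq_ofReal hw hz hzw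
  have ht2 : t ^ 2 ≤ π ^ 2 := sq_le_sq' (abs_le.mp ht).1 (abs_le.mp ht).2
  calc t ^ 2 + (1 - r ^ 2)
      ≤ (1 - r) * π ^ 2 + r * t ^ 2 + (1 - r) * 2 := by nlinarith
    _ ≤ 2 * (1 - r) * π ^ 2 + 4 * (r * t ^ 2) := by
        have hπ : 2 ≤ π ^ 2 := by nlinarith [Real.pi_gt_three]
        nlinarith [mul_nonneg hr (sq_nonneg t)]
    _ ≤ π ^ 2 * (2 - 2 * r * Real.cos t) := by nlinarith

theorem norm_exp_sub_one_sub_le (t : ℝ) :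
    ‖Complex.exp (Complex.I * t) - 1 - Complex.I * t‖ ≤ 2 * t ^ 2 := by
  have hnorm : ‖Complex.I * t‖ = |t| := by simp
  rcases le_total |t| 1 with ht | ht
  · have := Complex.norm_exp_sub_one_sub_id_le (hnorm.trans_le ht)
    rw [hnorm, sq_abs] at this
    linarith [sq_nonneg t]
  · calc ‖Complex.exp (Complex.I * t) - 1 - Complex.I * t‖
        ≤ ‖Complex.exp (Complex.I * t) - 1‖ + ‖Complex.I * t‖ := norm_sub_le _ _
      _ ≤ |t| + |t| := by
          rw [hnorm]
          gcongr
          exact Real.norm_exp_I_mul_ofReal_sub_one_le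
      _ ≤ 2 * t ^ 2 := by nlinarith [sq_abs t]

theorem norm_exp_smul_sub_sub_le (hw : ‖w‖ = 1) (hz : ‖z‖ = 1) (hzw : inner ℂ w z = r)
    (hr : 0 ≤ r) (t : ℝ) :
    ‖Complex.exp (Complex.I * t) • z - w - ((Complex.I * t) • w + (z - (r : ℂ) • w))‖ ≤
      3 * ‖(Complex.I * t) • w + (z - (r : ℂ) • w)‖ ^ 2 := by
  have hr1 := le_one_of_inner_eq_ofReal hw hz hzw
  have hη := norm_sq_sub_smul hw hz hzw
  rw [norm_sq_I_mul_smul_add hw hz hzw]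
  set e := Complex.exp (Complex.I * t)
  set η := z - (r : ℂ) • w
  have heq : e • z - w - ((Complex.I * t) • w + η) =
      (e - 1) • η + (((r : ℂ) - 1) * e + (e - 1 - Complex.I * t)) • w := by
    simp only [η]; module
  have hcoef : ‖((r : ℂ) - 1) * e + (e - 1 - Complex.I * t)‖ ≤ (1 - r) + 2 * t ^ 2 := by
    refine (norm_add_le _ _).trans (add_le_add (le_of_eq ?_) (norm_exp_sub_one_sub_le t))
    rw [norm_mul, Complex.norm_exp_I_mul_ofReal, mul_one, ← Complex.ofReal_one,
      ← Complex.ofReal_sub, Complex.norm_real, Real.norm_eq_abs, abs_sub_comm,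
      abs_of_nonneg (by linarith)]
  calc ‖e • z - w - ((Complex.I * t) • w + η)‖
      ≤ |t| * ‖η‖ + ((1 - r) + 2 * t ^ 2) := by
        rw [heq]
        refine (norm_add_le _ _).trans ?_
        rw [norm_smul, norm_smul, hw, mul_one]
        gcongr
        exact Real.norm_exp_I_mul_ofReal_sub_one_le
    _ ≤ 3 * (t ^ 2 + (1 - r ^ 2)) := by
        nlinarith [sq_nonneg (|t| - ‖η‖), sq_abs t]

theorem abs_im_inner_exp_smul_sub_le (hw : ‖w‖ = 1) (hz : ‖z‖ = 1) (hzw : inner ℂ w z = r)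
    (hr : 0 ≤ r) (t : ℝ) :
    |(inner ℂ w (Complex.exp (Complex.I * t) • z)).im - t| ≤
      2 * ‖(Complex.I * t) • w + (z - (r : ℂ) • w)‖ ^ 3 := by
  have hr1 := le_one_of_inner_eq_ofReal hw hz hzw
  have hv := norm_sq_I_mul_smul_add hw hz hzw t
  set x := ‖(Complex.I * t) • w + (z - (r : ℂ) • w)‖
  have hxt : |t| ≤ x := abs_le_of_sq_le_sq (by nlinarith) (norm_nonneg _)
  have him : (inner ℂ w (Complex.exp (Complex.I * t) • z)).im = r * Real.sin t := by
    rw [inner_smul_right, hzw, Complex.im_mul_ofReal, mul_comm Complex.I,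
      Complex.exp_ofReal_mul_I_im, mul_comm]
  calc |(inner ℂ w (Complex.exp (Complex.I * t) • z)).im - t|
      = |r * (t - Real.sin t) + (1 - r) * t| := by
        rw [him, abs_sub_comm]; ring_nf
    _ ≤ r * (|t| ^ 3 / 6) + (1 - r) * |t| := by
        refine (abs_add_le _ _).trans ?_
        rw [abs_mul, abs_mul, abs_of_nonneg hr, abs_of_nonneg (sub_nonneg.mpr hr1)]
        gcongr
        exact Real.abs_sub_sin_le t
    _ ≤ x ^ 2 * x + x ^ 2 * x := by
        have hη : 1 - r ≤ x ^ 2 := by nlinarith [sq_nonneg t]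
        have ht : r * (|t| ^ 3 / 6) ≤ |t| ^ 2 * |t| := by
          nlinarith [pow_nonneg (abs_nonneg t) 3]
        have : 0 ≤ x := norm_nonneg _
        exact add_le_add (ht.trans (by gcongr)) (by gcongr)
    _ = 2 * x ^ 3 := by ring

end Orbit

section Reduction

variable {N : ℕ}

theorem periodic_reduction_integrand (k : ℕ) (ψ : EuclideanSpace ℂ (Fin N) → ℂ)
    (z : EuclideanSpace ℂ (Fin N)) :
    Function.Periodic (fun t : ℝ => Complex.exp (-(Complex.I * k * t)) *
      ψ (Complex.exp (Complex.I * t) • z)) (2 * π) := by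
  intro t
  have hexp : Complex.exp (Complex.I * ((t + 2 * π : ℝ) : ℂ)) = Complex.exp (Complex.I * t) := by
    rw [show Complex.I * ((t + 2 * π : ℝ) : ℂ) = Complex.I * t + 2 * π * Complex.I by
      push_cast; ring]
    exact Complex.exp_periodic _
  have hpow (s : ℝ) : Complex.exp (-(Complex.I * k * s)) = (Complex.exp (Complex.I * s) ^ k)⁻¹ := by
    rw [← Complex.exp_nat_mul, ← Complex.exp_neg]
    ring_nf
  simp only [hpow, hexp]

theorem reduction_eq_of_coe_eq_smul (k : ℕ) (ψ : EuclideanSpace ℂ (Fin N) → ℂ) {z z' : USphere N}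
    {θ : ℝ} (h : (z' : EuclideanSpace ℂ (Fin N)) = Complex.exp (Complex.I * θ) • z.1) :
    reduction k ψ z' = Complex.exp (Complex.I * k * θ) * reduction k ψ z := by
  have hper := periodic_reduction_integrand k ψ z.1
  have hshift (t : ℝ) :
      Complex.exp (-(Complex.I * k * t)) * ψ (Complex.exp (Complex.I * t) • z'.1) =
        Complex.exp (Complex.I * k * θ) * (Complex.exp (-(Complex.I * k * (t + θ : ℝ))) *
          ψ (Complex.exp (Complex.I * (t + θ : ℝ)) • z.1)) := by
    rw [h, smul_smul, ← Complex.exp_add, ← mul_assoc, ← Complex.exp_add]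
    push_cast
    ring_nf
  simp only [reduction, hshift]
  rw [intervalIntegral.integral_const_mul, intervalIntegral.integral_comp_add_right
      (fun t : ℝ => Complex.exp (-(Complex.I * k * t)) * ψ (Complex.exp (Complex.I * t) • z.1)),
    zero_add, add_comm (2 * π) θ, hper.intervalIntegral_add_eq θ 0, zero_add]
  ring

theorem continuous_reduction (k : ℕ) {ψ : EuclideanSpace ℂ (Fin N) → ℂ} (hψ : Continuous ψ) :
    Continuous (reduction k ψ) :=
  continuous_const.mul <| intervalIntegral.continuous_parametric_intervalIntegral_of_continuous'
    (by fun_prop) _ _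

theorem memLp_two_reducedState (k : ℕ) (A : Matrix (Fin N) (Fin N) ℂ) (w : USphere N) :
    MemLp (reducedState k A w) 2 (surface N) := by
  have hψ : Continuous (gaussianState k A w.1) := by
    have := continuous_quadForm A
    unfold gaussianState
    fun_prop
  have : IsFiniteMeasure (surface N) := inferInstanceAs (IsFiniteMeasure (Measure.toSphere _))
  exact (continuous_reduction k hψ).memLp_of_hasCompactSupport
    (HasCompactSupport.of_compactSpace _)

end Reduction

section Exponent

variable {N : ℕ}

/-- The exponent of the Gaussian centred at the origin, `ψ_{A,0} = exp (k * gaussianExponent A)`. -/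
noncomputable def gaussianExponent (A : Matrix (Fin N) (Fin N) ℂ)
    (v : EuclideanSpace ℂ (Fin N)) : ℂ :=
  (quadForm A v - (‖v‖ : ℂ) ^ 2) / 2

theorem continuous_gaussianExponent (A : Matrix (Fin N) (Fin N) ℂ) :
    Continuous (gaussianExponent A) := by
  have := continuous_quadForm A
  unfold gaussianExponent
  fun_prop

theorem gaussianExponent_ofReal_smul (A : Matrix (Fin N) (Fin N) ℂ) (r : ℝ)
    (v : EuclideanSpace ℂ (Fin N)) :
    gaussianExponent A ((r : ℂ) • v) = r ^ 2 * gaussianExponent A v := by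
  have hr : ((|r| : ℝ) : ℂ) ^ 2 = (r : ℂ) ^ 2 := by
    rw [← Complex.ofReal_pow, sq_abs, Complex.ofReal_pow]
  rw [gaussianExponent, quadForm_smul, norm_smul, Complex.norm_real, Real.norm_eq_abs,
    Complex.ofReal_mul, mul_pow, hr, gaussianExponent]
  ring

theorem re_gaussianExponent_le {A : Matrix (Fin N) (Fin N) ℂ} {δ : ℝ}
    {v : EuclideanSpace ℂ (Fin N)} (hA : ‖quadForm A v‖ ≤ (1 - δ) * ‖v‖ ^ 2) :
    (gaussianExponent A v).re ≤ -(δ / 2) * ‖v‖ ^ 2 := by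
  have hre := Complex.re_le_norm (quadForm A v)
  rw [gaussianExponent, Complex.div_ofNat_re, Complex.sub_re, ← Complex.ofReal_pow,
    Complex.ofReal_re]
  linarith

theorem norm_gaussianExponent_sub_le (A : Matrix (Fin N) (Fin N) ℂ)
    (u v : EuclideanSpace ℂ (Fin N)) :
    ‖gaussianExponent A u - gaussianExponent A v‖ ≤
      (∑ i, ∑ j, ‖A i j‖ + 1) / 2 * ((‖u‖ + ‖v‖) * ‖u - v‖) := by
  have hsq : ‖(‖u‖ : ℂ) ^ 2 - (‖v‖ : ℂ) ^ 2‖ ≤ (‖u‖ + ‖v‖) * ‖u - v‖ := by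
    rw [sq_sub_sq, norm_mul, ← Complex.ofReal_add, ← Complex.ofReal_sub, Complex.norm_real,
      Complex.norm_real, Real.norm_of_nonneg (by positivity)]
    gcongr
    exact abs_norm_sub_norm_le u v
  have heq : gaussianExponent A u - gaussianExponent A v =
      ((quadForm A u - quadForm A v) - ((‖u‖ : ℂ) ^ 2 - (‖v‖ : ℂ) ^ 2)) / 2 := by
    simp only [gaussianExponent]; ring
  have hnorm := norm_sub_le (quadForm A u - quadForm A v) ((‖u‖ : ℂ) ^ 2 - (‖v‖ : ℂ) ^ 2)
  rw [heq, norm_div, Complex.norm_ofNat]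
  linarith [norm_quadForm_sub_le A u v]

/-- The phase of the integrand of `Ψ_{A,w}(z)` along the orbit `t ↦ e^{it} z`, see
`reducedState_eq_integral_exp_orbitPhase`. -/
noncomputable def orbitPhase (A : Matrix (Fin N) (Fin N) ℂ) (w z : EuclideanSpace ℂ (Fin N))
    (t : ℝ) : ℂ :=
  gaussianExponent A (Complex.exp (Complex.I * t) • z - w) +
    Complex.I * ((inner ℂ w (Complex.exp (Complex.I * t) • z)).im - t : ℝ)

theorem continuous_orbitPhase (A : Matrix (Fin N) (Fin N) ℂ) (w z : EuclideanSpace ℂ (Fin N)) :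
    Continuous (orbitPhase A w z) := by
  refine ((continuous_gaussianExponent A).comp (by fun_prop)).add <| continuous_const.mul <|
    Complex.continuous_ofReal.comp <| (Complex.continuous_im.comp ?_).sub continuous_id
  fun_prop

theorem gaussianState_eq_exp (k : ℕ) (A : Matrix (Fin N) (Fin N) ℂ)
    (w z : EuclideanSpace ℂ (Fin N)) :
    gaussianState k A w z =
      Complex.exp (k * (gaussianExponent A (z - w) + Complex.I * (inner ℂ w z).im)) := by
  have hinner : ∑ i, z i * conj (w i) = inner ℂ w z := rfl
  have hnorm : (‖z - w‖ : ℂ) ^ 2 = ‖z‖ ^ 2 - 2 * (inner ℂ w z).re + ‖w‖ ^ 2 := by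
    rw [norm_sub_rev]
    exact_mod_cast (norm_sub_sq (𝕜 := ℂ) w z).trans (by simp; ring)
  rw [gaussianState, hinner, gaussianExponent, hnorm, ← Complex.exp_add, ← Complex.exp_add,
    ← Complex.exp_add]
  congr 1
  linear_combination -(k : ℂ) * Complex.re_add_im (inner ℂ w z)

theorem reducedState_eq_integral_exp_orbitPhase (k : ℕ) (A : Matrix (Fin N) (Fin N) ℂ)
    (w z : USphere N) :
    reducedState k A w z = 1 / (2 * π) * ∫ t in -π..π, Complex.exp (k * orbitPhase A w z t) := by
  have hper := (periodic_reduction_integrand k (gaussianState k A w) z.1).intervalIntegral_add_eq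
    0 (-π)
  rw [zero_add, neg_add_eq_sub, two_mul, add_sub_cancel_right, ← two_mul] at hper
  rw [reducedState, reduction, hper]
  congr 2 with t
  rw [gaussianState_eq_exp, ← Complex.exp_add, orbitPhase]
  push_cast
  ring_nf

theorem gaussianSymbol_eq_integral_exp (A : Matrix (Fin N) (Fin N) ℂ) (w : USphere N)
    {η : EuclideanSpace ℂ (Fin N)} (hη : inner ℂ w.1 η = 0) :
    gaussianSymbol A w η =
      1 / (2 * π) * ∫ s : ℝ, Complex.exp (gaussianExponent A ((Complex.I * s) • w.1 + η)) := by
  have hnorm (s : ℝ) : (‖(Complex.I * s) • w.1 + η‖ : ℂ) ^ 2 = (s : ℂ) ^ 2 + (‖η‖ : ℂ) ^ 2 := by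
    rw [← Complex.ofReal_pow,
      norm_sq_smul_add_of_inner_eq_zero (norm_eq_of_mem_sphere w) hη (Complex.I * s)]
    simp [← Complex.ofReal_pow]
  rw [gaussianSymbol, mul_assoc, ← integral_const_mul]
  congr 2 with s
  rw [gaussianExponent, hnorm, ← Complex.exp_add, ← Complex.exp_add]
  ring_nf

theorem integral_exp_mul_gaussianExponent (k : ℕ) (A : Matrix (Fin N) (Fin N) ℂ) (w : USphere N)
    {η : EuclideanSpace ℂ (Fin N)} (hη : inner ℂ w.1 η = 0) :
    1 / (2 * π) * ∫ t : ℝ, Complex.exp (k * gaussianExponent A ((Complex.I * t) • w.1 + η)) =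
      ((√k)⁻¹ : ℝ) * gaussianSymbol A w ((√k : ℂ) • η) := by
  have hscale (t : ℝ) : (k : ℂ) * gaussianExponent A ((Complex.I * t) • w.1 + η) =
      gaussianExponent A ((Complex.I * (√k * t : ℝ)) • w.1 + (√k : ℂ) • η) := by
    have hk : (k : ℂ) = (√k : ℂ) ^ 2 := mod_cast (Real.sq_sqrt (Nat.cast_nonneg k)).symm
    rw [hk, ← gaussianExponent_ofReal_smul, smul_add, smul_smul]
    push_cast
    ring_nf
  simp only [hscale]
  rw [Measure.integral_comp_mul_left (fun s : ℝ => Complex.exp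
      (gaussianExponent A ((Complex.I * s) • w.1 + (√k : ℂ) • η))),
    gaussianSymbol_eq_integral_exp A w (by rw [inner_smul_right, hη, mul_zero]),
    abs_of_nonneg (by positivity), Complex.real_smul]
  ring

end Exponent

section Laplace

theorem norm_exp_sub_exp_le {x y : ℂ} {m : ℝ} (hx : x.re ≤ m) (hy : y.re ≤ m) :
    ‖Complex.exp x - Complex.exp y‖ ≤ ‖x - y‖ * Real.exp m := by
  rw [mul_comm]
  refine Convex.norm_image_sub_le_of_norm_deriv_le (𝕜 := ℂ) (s := {w : ℂ | w.re ≤ m})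
    (fun w _ => Complex.differentiableAt_exp) (fun w hw => ?_) (convex_halfSpace_re_le m) hy hx
  rw [Complex.deriv_exp, Complex.norm_exp]
  exact Real.exp_le_exp.mpr hw

theorem cube_mul_exp_le {κ : ℝ} (hκ : 0 < κ) {y : ℝ} (hy : 0 ≤ y) :
    y ^ 3 * Real.exp (-(2 * κ * y ^ 2)) ≤ (1 + 2 / κ ^ 2) * Real.exp (-(κ * y ^ 2)) := by
  have hcube : y ^ 3 ≤ 1 + y ^ 4 := by
    nlinarith [sq_nonneg (y ^ 2 - y / 2), sq_nonneg (y - 2), sq_nonneg (y - 1), pow_nonneg hy 3]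
  have hquad : y ^ 4 ≤ 2 / κ ^ 2 * Real.exp (κ * y ^ 2) := by
    have := Real.pow_div_factorial_le_exp (κ * y ^ 2) (by positivity) 2
    rw [Nat.factorial_two, Nat.cast_ofNat] at this
    rw [div_mul_eq_mul_div, le_div_iff₀ (by positivity)]
    linarith
  have hone : 1 ≤ Real.exp (κ * y ^ 2) := Real.one_le_exp (by positivity)
  calc y ^ 3 * Real.exp (-(2 * κ * y ^ 2))
      ≤ ((1 + 2 / κ ^ 2) * Real.exp (κ * y ^ 2)) * Real.exp (-(2 * κ * y ^ 2)) := by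
        gcongr; linarith
    _ = (1 + 2 / κ ^ 2) * Real.exp (-(κ * y ^ 2)) := by
        rw [mul_assoc, ← Real.exp_add]; ring_nf

theorem natCast_mul_cube_mul_exp_le {κ : ℝ} (hκ : 0 < κ) {k : ℕ} (hk : 1 ≤ k) {x : ℝ}
    (hx : 0 ≤ x) :
    k * (x ^ 3 * Real.exp (-(2 * κ * (k * x ^ 2)))) ≤
      (1 + 2 / κ ^ 2) / √k * Real.exp (-(κ * (k * x ^ 2))) := by
  have hk0 : 0 < √(k : ℝ) := by positivity
  have hsq : √(k : ℝ) ^ 2 = k := Real.sq_sqrt (Nat.cast_nonneg k)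
  have := cube_mul_exp_le hκ (y := √k * x) (by positivity)
  rw [mul_pow, mul_pow, hsq, pow_succ, hsq] at this
  rw [div_mul_eq_mul_div, le_div_iff₀ hk0]
  linarith

theorem integrable_exp_neg_mul_sq_add {b : ℝ} (hb : 0 < b) (h : ℝ) :
    Integrable fun t : ℝ => Real.exp (-(b * (t ^ 2 + h ^ 2))) := by
  convert (integrable_exp_neg_mul_sq hb).mul_const (Real.exp (-(b * h ^ 2))) using 2
  rw [← Real.exp_add]; ring_nf

theorem integral_exp_neg_mul_sq_add (b h : ℝ) :
    ∫ t : ℝ, Real.exp (-(b * (t ^ 2 + h ^ 2))) = √(π / b) * Real.exp (-(b * h ^ 2)) := by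
  rw [← integral_gaussian, ← integral_mul_const]
  congr with t
  rw [← Real.exp_add]; ring_nf

theorem re_natCast_mul_le {a : ℝ} {u : ℂ} (hu : u.re ≤ -a) (k : ℕ) :
    (k * u).re ≤ -(k * a) := by
  rw [← Complex.ofReal_natCast, Complex.re_ofReal_mul, ← mul_neg]
  gcongr

theorem norm_exp_natCast_mul_sub_le {κ M x : ℝ} (hκ : 0 < κ) (hx : 0 ≤ x) {u v : ℂ}
    (hu : u.re ≤ -(2 * κ * x ^ 2)) (hv : v.re ≤ -(2 * κ * x ^ 2)) (huv : ‖u - v‖ ≤ M * x ^ 3)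
    (hM : 0 ≤ M) {k : ℕ} (hk : 1 ≤ k) :
    ‖Complex.exp (k * u) - Complex.exp (k * v)‖ ≤
      M * ((1 + 2 / κ ^ 2) / √k * Real.exp (-(κ * (k * x ^ 2)))) :=
  calc ‖Complex.exp (k * u) - Complex.exp (k * v)‖
      ≤ ‖k * u - k * v‖ * Real.exp (-(k * (2 * κ * x ^ 2))) :=
        norm_exp_sub_exp_le (re_natCast_mul_le hu k) (re_natCast_mul_le hv k)
    _ ≤ k * (M * x ^ 3) * Real.exp (-(k * (2 * κ * x ^ 2))) := by
        rw [← mul_sub, norm_mul, Complex.norm_natCast]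
        gcongr
    _ = M * (k * (x ^ 3 * Real.exp (-(2 * κ * (k * x ^ 2))))) := by ring_nf
    _ ≤ M * ((1 + 2 / κ ^ 2) / √k * Real.exp (-(κ * (k * x ^ 2)))) := by
        exact mul_le_mul_of_nonneg_left (natCast_mul_cube_mul_exp_le hκ hk hx) hM

theorem norm_exp_natCast_mul_le {κ x : ℝ} (hκ : 0 < κ) (hx : 1 ≤ x) {u : ℂ}
    (hu : u.re ≤ -(2 * κ * x ^ 2)) {k : ℕ} (hk : 1 ≤ k) :
    ‖Complex.exp (k * u)‖ ≤ (1 + 2 / κ ^ 2) / √k * Real.exp (-(κ * (k * x ^ 2))) := by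
  have hk1 : (1 : ℝ) ≤ k * x ^ 3 :=
    one_le_mul_of_one_le_of_one_le (by exact_mod_cast hk) (one_le_pow₀ hx)
  calc ‖Complex.exp (k * u)‖
      ≤ Real.exp (-(2 * κ * (k * x ^ 2))) := by
        rw [Complex.norm_exp, Real.exp_le_exp]
        exact (re_natCast_mul_le hu k).trans_eq (by ring)
    _ ≤ k * x ^ 3 * Real.exp (-(2 * κ * (k * x ^ 2))) :=
        le_mul_of_one_le_left (Real.exp_nonneg _) hk1
    _ ≤ (1 + 2 / κ ^ 2) / √k * Real.exp (-(κ * (k * x ^ 2))) := by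
        rw [mul_assoc]
        exact natCast_mul_cube_mul_exp_le hκ hk (zero_le_one.trans hx)

section

variable {f g : ℝ → ℂ} {κ M h : ℝ} {k : ℕ}

theorem norm_indicator_exp_sub_exp_le (hκ : 0 < κ) (hM : 1 ≤ M)
    (hfre : ∀ t, |t| ≤ π → (f t).re ≤ -(2 * κ * (t ^ 2 + h ^ 2)))
    (hgre : ∀ t, (g t).re ≤ -(2 * κ * (t ^ 2 + h ^ 2)))
    (hfg : ∀ t, |t| ≤ π → ‖f t - g t‖ ≤ M * √(t ^ 2 + h ^ 2) ^ 3) (hk : 1 ≤ k) (t : ℝ) :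
    ‖(Set.Ioc (-π) π).indicator (fun t => Complex.exp (k * f t)) t - Complex.exp (k * g t)‖ ≤
      M * ((1 + 2 / κ ^ 2) / √k) * Real.exp (-(κ * k * (t ^ 2 + h ^ 2))) := by
  have hsq : √(t ^ 2 + h ^ 2) ^ 2 = t ^ 2 + h ^ 2 := Real.sq_sqrt (by positivity)
  rw [mul_assoc, mul_assoc κ, ← hsq]
  by_cases ht : t ∈ Set.Ioc (-π) π
  · have ht' : |t| ≤ π := abs_le.mpr ⟨ht.1.le, ht.2⟩
    rw [Set.indicator_of_mem ht]
    exact norm_exp_natCast_mul_sub_le hκ (Real.sqrt_nonneg _) (hsq.symm ▸ hfre t ht')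
      (hsq.symm ▸ hgre t) (hfg t ht') (zero_le_one.trans hM) hk
  · have ht3 : 3 ≤ |t| := by
      by_contra! hlt
      have := Real.pi_gt_three
      exact ht ⟨by linarith [neg_abs_le t], by linarith [le_abs_self t]⟩
    have hx : 1 ≤ √(t ^ 2 + h ^ 2) := by
      rw [Real.one_le_sqrt]
      nlinarith [sq_abs t, sq_nonneg h]
    rw [Set.indicator_of_notMem ht, zero_sub, norm_neg]
    exact (norm_exp_natCast_mul_le hκ hx (hsq.symm ▸ hgre t) hk).trans
      (le_mul_of_one_le_left (by positivity) hM)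

/-- Laplace's method: the Gaussian has width and mass of order `k^{-1/2}`, so that a cubic error in
the exponent amounts to `k * k^{-3/2} * k^{-1/2} = k⁻¹`. -/
theorem norm_integral_exp_sub_integral_exp_le (hf : Continuous f) (hg : Continuous g)
    (hκ : 0 < κ) (hM : 1 ≤ M)
    (hfre : ∀ t, |t| ≤ π → (f t).re ≤ -(2 * κ * (t ^ 2 + h ^ 2)))
    (hgre : ∀ t, (g t).re ≤ -(2 * κ * (t ^ 2 + h ^ 2)))
    (hfg : ∀ t, |t| ≤ π → ‖f t - g t‖ ≤ M * √(t ^ 2 + h ^ 2) ^ 3) (hk : 1 ≤ k) :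
    ‖(∫ t in -π..π, Complex.exp (k * f t)) - ∫ t, Complex.exp (k * g t)‖ ≤
      M * (1 + 2 / κ ^ 2) * √(π / κ) / k * Real.exp (-(κ * (k * h ^ 2))) := by
  have hk0 : (0 : ℝ) < k := by positivity
  have hgauss {b : ℝ} (hb : 0 < b) := integrable_exp_neg_mul_sq_add hb h
  have hfint : IntegrableOn (fun t => Complex.exp (k * f t)) (Set.Ioc (-π) π) :=
    (Continuous.integrableOn_Icc (by fun_prop)).mono_set Set.Ioc_subset_Icc_self
  have hgint : Integrable fun t => Complex.exp (k * g t) := by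
    refine (hgauss (b := k * (2 * κ)) (by positivity)).mono' (by fun_prop) (.of_forall fun t => ?_)
    rw [Complex.norm_exp, Real.exp_le_exp, mul_assoc]
    exact re_natCast_mul_le (hgre t) k
  rw [intervalIntegral.integral_of_le (by linarith [Real.pi_pos]),
    ← integral_indicator measurableSet_Ioc,
    ← integral_sub (hfint.integrable_indicator measurableSet_Ioc) hgint]
  refine (norm_integral_le_of_norm_le ((hgauss (by positivity)).const_mul _)
    (.of_forall (norm_indicator_exp_sub_exp_le hκ hM hfre hgre hfg hk))).trans_eq ?_
  rw [integral_const_mul, integral_exp_neg_mul_sq_add, ← div_div, Real.sqrt_div' _ hk0.le,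
    mul_assoc κ]
  have hkk : (√(k : ℝ))⁻¹ * (√(k : ℝ))⁻¹ = (k : ℝ)⁻¹ := by
    rw [← mul_inv, Real.mul_self_sqrt hk0.le]
  linear_combination
    M * (1 + 2 / κ ^ 2) * √(π / κ) * Real.exp (-(κ * (k * h ^ 2))) * hkk

end

end Laplace

section Asymptotics

variable {N : ℕ} {A B : Matrix (Fin N) (Fin N) ℂ} {r : ℝ}

theorem re_orbitPhase_le {δ : ℝ} (hδ : 0 < δ) (hA : ∀ v, ‖quadForm A v‖ ≤ (1 - δ) * ‖v‖ ^ 2)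
    {w z : EuclideanSpace ℂ (Fin N)} (hw : ‖w‖ = 1) (hz : ‖z‖ = 1) (hzw : inner ℂ w z = r)
    (hr : 0 ≤ r) {t : ℝ} (ht : |t| ≤ π) :
    (orbitPhase A w z t).re ≤ -(δ / (2 * π ^ 2) * (t ^ 2 + ‖z - (r : ℂ) • w‖ ^ 2)) := by
  have hre : (orbitPhase A w z t).re =
      (gaussianExponent A (Complex.exp (Complex.I * t) • z - w)).re := by
    simp [orbitPhase]
  have hle := sq_norm_I_mul_smul_add_le hw hz hzw hr ht
  rw [norm_sq_I_mul_smul_add hw hz hzw, ← norm_sq_sub_smul hw hz hzw] at hle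
  calc (orbitPhase A w z t).re
      ≤ -(δ / 2) * ‖Complex.exp (Complex.I * t) • z - w‖ ^ 2 :=
        hre.trans_le (re_gaussianExponent_le (hA _))
    _ = -(δ / (2 * π ^ 2) * (π ^ 2 * ‖Complex.exp (Complex.I * t) • z - w‖ ^ 2)) := by
        field_simp
    _ ≤ -(δ / (2 * π ^ 2) * (t ^ 2 + ‖z - (r : ℂ) • w‖ ^ 2)) := by gcongr

theorem re_gaussianExponent_tangent_le {δ : ℝ} (hδ : 0 < δ)
    (hA : ∀ v, ‖quadForm A v‖ ≤ (1 - δ) * ‖v‖ ^ 2) {w z : EuclideanSpace ℂ (Fin N)}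
    (hw : ‖w‖ = 1) (hz : ‖z‖ = 1) (hzw : inner ℂ w z = r) (t : ℝ) :
    (gaussianExponent A ((Complex.I * t) • w + (z - (r : ℂ) • w))).re ≤
      -(δ / (2 * π ^ 2) * (t ^ 2 + ‖z - (r : ℂ) • w‖ ^ 2)) := by
  refine (re_gaussianExponent_le (hA _)).trans ?_
  rw [norm_sq_I_mul_smul_add hw hz hzw, ← norm_sq_sub_smul hw hz hzw, neg_mul, neg_le_neg_iff]
  gcongr
  nlinarith [Real.pi_gt_three]

theorem norm_orbitPhase_sub_gaussianExponent_le (A : Matrix (Fin N) (Fin N) ℂ)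
    {w z : EuclideanSpace ℂ (Fin N)} (hw : ‖w‖ = 1) (hz : ‖z‖ = 1) (hzw : inner ℂ w z = r)
    (hr : 0 ≤ r) (t : ℝ) :
    ‖orbitPhase A w z t - gaussianExponent A ((Complex.I * t) • w + (z - (r : ℂ) • w))‖ ≤
      (9 / 2 * (∑ i, ∑ j, ‖A i j‖ + 1) + 2) *
        ‖(Complex.I * t) • w + (z - (r : ℂ) • w)‖ ^ 3 := by
  have hu := norm_exp_smul_sub_le hw hz hzw hr t
  have huv := norm_exp_smul_sub_sub_le hw hz hzw hr t
  have him := abs_im_inner_exp_smul_sub_le hw hz hzw hr t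
  have hexp := norm_gaussianExponent_sub_le A (Complex.exp (Complex.I * t) • z - w)
    ((Complex.I * t) • w + (z - (r : ℂ) • w))
  have hS : 0 ≤ ∑ i, ∑ j, ‖A i j‖ := by positivity
  rw [orbitPhase, add_sub_right_comm]
  set u := Complex.exp (Complex.I * t) • z - w
  set v := (Complex.I * t) • w + (z - (r : ℂ) • w)
  set S := ∑ i, ∑ j, ‖A i j‖
  set y : ℝ := (inner ℂ w (Complex.exp (Complex.I * t) • z)).im - t
  calc ‖gaussianExponent A u - gaussianExponent A v + Complex.I * (y : ℂ)‖
      ≤ (S + 1) / 2 * ((‖u‖ + ‖v‖) * ‖u - v‖) + |y| := by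
        refine (norm_add_le _ _).trans (add_le_add hexp ?_)
        simp
    _ ≤ (S + 1) / 2 * ((2 * ‖v‖ + ‖v‖) * (3 * ‖v‖ ^ 2)) + 2 * ‖v‖ ^ 3 := by gcongr
    _ = (9 / 2 * (S + 1) + 2) * ‖v‖ ^ 3 := by ring

theorem exists_norm_reducedState_sub_gaussianSymbol_le (hA : A ∈ Disk N) :
    ∃ C ≥ 0, ∃ κ > 0, ∀ w z : USphere N, ∀ r : ℝ, 0 ≤ r → inner ℂ w.1 z.1 = r →
      ∀ k : ℕ, 1 ≤ k →
        ‖reducedState k A w z -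
          ((√k)⁻¹ : ℝ) * gaussianSymbol A w ((√k : ℂ) • (z.1 - (r : ℂ) • w.1))‖ ≤
        C / k * Real.exp (-(κ * (k * (1 - r ^ 2)))) := by
  obtain ⟨δ, hδ, hQ⟩ := exists_norm_quadForm_le_of_mem_disk hA
  obtain ⟨κ, hκ⟩ : ∃ κ, 2 * κ = δ / (2 * π ^ 2) := ⟨δ / (2 * π ^ 2) / 2, by ring⟩
  have hκ0 : 0 < κ := by
    have : 0 < δ / (2 * π ^ 2) := by positivity
    linarith
  obtain ⟨M, hM⟩ : ∃ M, M = 9 / 2 * (∑ i, ∑ j, ‖A i j‖ + 1) + 2 := ⟨_, rfl⟩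
  have hM1 : 1 ≤ M := by
    have : 0 ≤ ∑ i, ∑ j, ‖A i j‖ := by positivity
    linarith
  refine ⟨1 / (2 * π) * (M * (1 + 2 / κ ^ 2) * √(π / κ)), by positivity, κ, hκ0,
    fun w z r hr hzw k hk => ?_⟩
  have hw : ‖w.1‖ = 1 := norm_eq_of_mem_sphere w
  have hz : ‖z.1‖ = 1 := norm_eq_of_mem_sphere z
  have hη := norm_sq_sub_smul hw hz hzw
  have hlaplace := norm_integral_exp_sub_integral_exp_le (continuous_orbitPhase A w.1 z.1)
    ((continuous_gaussianExponent A).comp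
      (f := fun t : ℝ => (Complex.I * t) • w.1 + (z.1 - (r : ℂ) • w.1)) (by fun_prop))
    hκ0 hM1
    (fun t ht => hκ ▸ re_orbitPhase_le hδ hQ hw hz hzw hr ht)
    (fun t => hκ ▸ re_gaussianExponent_tangent_le hδ hQ hw hz hzw t)
    (fun t _ => (norm_orbitPhase_sub_gaussianExponent_le A hw hz hzw hr t).trans_eq (by
      rw [hη, ← norm_sq_I_mul_smul_add hw hz hzw, Real.sqrt_sq (norm_nonneg _), hM])) hk
  rw [hη] at hlaplace
  have hprefactor : ‖(1 / (2 * π) : ℂ)‖ = 1 / (2 * π) := by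
    rw [← Complex.ofReal_ofNat, ← Complex.ofReal_mul, ← Complex.ofReal_one, ← Complex.ofReal_div,
      Complex.norm_real, Real.norm_of_nonneg (by positivity)]
  rw [← integral_exp_mul_gaussianExponent k A w (inner_sub_smul_eq_zero hw hzw),
    reducedState_eq_integral_exp_orbitPhase, ← mul_sub, norm_mul, hprefactor]
  exact (mul_le_mul_of_nonneg_left hlaplace (by positivity)).trans_eq (by ring)

theorem exists_coe_eq_exp_smul_and_inner_eq_norm (w z : USphere N) :
    ∃ (θ : ℝ) (z' : USphere N), z'.1 = Complex.exp (Complex.I * θ) • z.1 ∧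
      inner ℂ w.1 z'.1 = (‖inner ℂ w.1 z.1‖ : ℂ) := by
  set c := inner ℂ w.1 z.1
  refine ⟨-c.arg, ⟨Complex.exp (Complex.I * (-c.arg : ℝ)) • z.1, ?_⟩, rfl, ?_⟩
  · rw [mem_sphere_zero_iff_norm, norm_smul, Complex.norm_exp_I_mul_ofReal,
      norm_eq_of_mem_sphere, one_mul]
  · rw [inner_smul_right]
    change _ * c = _
    rw [mul_comm]
    nth_rewrite 1 [← Complex.norm_mul_exp_arg_mul_I c]
    rw [mul_assoc, ← Complex.exp_add]
    push_cast
    ring_nf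
    simp

theorem exists_norm_reducedState_sub_le (hA : A ∈ Disk N) (hB : B ∈ Disk N) {w : USphere N} {s : ℂ}
    (hs : ∀ η, inner ℂ w.1 η = 0 → gaussianSymbol A w η = s * gaussianSymbol B w η) :
    ∃ C ≥ 0, ∃ κ > 0, ∀ (z : USphere N) (k : ℕ), 1 ≤ k →
      ‖reducedState k A w z - s * reducedState k B w z‖ ≤
        C / k * Real.exp (-(κ * (k * (1 - ‖inner ℂ w.1 z.1‖ ^ 2)))) := by
  obtain ⟨C₁, hC₁, κ₁, hκ₁, h₁⟩ := exists_norm_reducedState_sub_gaussianSymbol_le hA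
  obtain ⟨C₂, hC₂, κ₂, hκ₂, h₂⟩ := exists_norm_reducedState_sub_gaussianSymbol_le hB
  refine ⟨C₁ + ‖s‖ * C₂, by positivity, min κ₁ κ₂, lt_min hκ₁ hκ₂, fun z k hk => ?_⟩
  obtain ⟨θ, z', hz', hinner⟩ := exists_coe_eq_exp_smul_and_inner_eq_norm w z
  set r := ‖inner ℂ w.1 z.1‖
  set η := (√k : ℂ) • (z'.1 - (r : ℂ) • w.1)
  set E := Real.exp (-(min κ₁ κ₂ * (k * (1 - r ^ 2))))
  have hη : inner ℂ w.1 η = 0 := by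
    rw [inner_smul_right, inner_sub_smul_eq_zero (norm_eq_of_mem_sphere w) hinner, mul_zero]
  have hr : 0 ≤ 1 - r ^ 2 := by
    rw [← norm_sq_sub_smul (norm_eq_of_mem_sphere w) (norm_eq_of_mem_sphere z') hinner]
    positivity
  have hA' : ‖reducedState k A w z' - ((√k)⁻¹ : ℝ) * gaussianSymbol A w η‖ ≤ C₁ / k * E :=
    (h₁ w z' r (norm_nonneg _) hinner k hk).trans (by unfold E; gcongr; exact min_le_left _ _)
  have hB' : ‖reducedState k B w z' - ((√k)⁻¹ : ℝ) * gaussianSymbol B w η‖ ≤ C₂ / k * E :=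
    (h₂ w z' r (norm_nonneg _) hinner k hk).trans (by unfold E; gcongr; exact min_le_right _ _)
  have hrotate : reducedState k A w z' - s * reducedState k B w z' =
      Complex.exp (Complex.I * (k * θ : ℝ)) *
        (reducedState k A w z - s * reducedState k B w z) := by
    simp only [reducedState, reduction_eq_of_coe_eq_smul k _ hz']
    push_cast
    ring_nf
  calc ‖reducedState k A w z - s * reducedState k B w z‖
      = ‖reducedState k A w z' - s * reducedState k B w z'‖ := by
        rw [hrotate, norm_mul, Complex.norm_exp_I_mul_ofReal, one_mul]
    _ = ‖(reducedState k A w z' - ((√k)⁻¹ : ℝ) * gaussianSymbol A w η) -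
          s * (reducedState k B w z' - ((√k)⁻¹ : ℝ) * gaussianSymbol B w η)‖ := by
        rw [hs η hη]; ring_nf
    _ ≤ C₁ / k * E + ‖s‖ * (C₂ / k * E) := by
        refine (norm_sub_le _ _).trans (add_le_add hA' ?_)
        rw [norm_mul]
        gcongr
    _ = (C₁ + ‖s‖ * C₂) / k * E := by ring

end Asymptotics

section Symbol

theorem ofReal_mul_cpow {r : ℝ} (hr : 0 < r) {z : ℂ} (hz : z ≠ 0) (s : ℂ) :
    (r * z : ℂ) ^ s = (r : ℂ) ^ s * z ^ s := by
  have hr0 : (r : ℂ) ≠ 0 := Complex.ofReal_ne_zero.mpr hr.ne'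
  rw [Complex.cpow_def_of_ne_zero (mul_ne_zero hr0 hz), Complex.cpow_def_of_ne_zero hr0,
    Complex.cpow_def_of_ne_zero hz, Complex.log_ofReal_mul hr hz, Complex.ofReal_log hr.le,
    ← Complex.exp_add, add_mul]

theorem integral_cexp_quadratic_of_re_pos {d : ℂ} (hd : 0 < d.re) (p q : ℂ) :
    ∫ s : ℝ, Complex.exp (-(d / 2) * s ^ 2 + p * s + q) =
      √(2 * π) * d ^ (-(1 / 2) : ℂ) * Complex.exp (q + p ^ 2 / (2 * d)) := by
  have hd0 : d ≠ 0 := by rintro rfl; simp at hd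
  have harg : d.arg ≠ π := fun h => hd.not_gt (Complex.arg_eq_pi_iff.mp h).1
  have hneg : (-(d / 2)).re < 0 := by
    rw [Complex.neg_re, Complex.div_ofNat_re]
    linarith
  have hsqrt : ((2 * π : ℝ) : ℂ) ^ (1 / 2 : ℂ) = √(2 * π) := by
    rw [Real.sqrt_eq_rpow, Complex.ofReal_cpow (by positivity)]
    norm_num
  have hroot : (π / -(-(d / 2)) : ℂ) ^ (1 / 2 : ℂ) = √(2 * π) * d ^ (-(1 / 2) : ℂ) := by
    rw [show (π / -(-(d / 2)) : ℂ) = (2 * π : ℝ) * d⁻¹ by push_cast; field_simp,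
      ofReal_mul_cpow (by positivity) (inv_ne_zero hd0), hsqrt, Complex.inv_cpow _ _ harg,
      Complex.cpow_neg]
  rw [integral_cexp_quadratic hneg, hroot]
  congr 2
  field_simp
  ring

theorem gaussianExponent_two (a b c : ℂ) (v : EuclideanSpace ℂ (Fin 2)) :
    gaussianExponent !![a, c; c, b] v =
      (a * v 0 ^ 2 + 2 * c * v 0 * v 1 + b * v 1 ^ 2 - (‖v 0‖ ^ 2 + ‖v 1‖ ^ 2 : ℝ)) / 2 := by
  rw [gaussianExponent, ← Complex.ofReal_pow, EuclideanSpace.norm_sq_eq]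
  simp [quadForm, Fin.sum_univ_two]
  ring

theorem inner_north (v : EuclideanSpace ℂ (Fin 2)) : inner ℂ north.1 v = v 0 := by
  simp [north, EuclideanSpace.inner_single_left]

theorem gaussianSymbol_north_single {a b c : ℂ} (ha : 0 < (1 + a).re) (ζ : ℂ) :
    gaussianSymbol !![a, c; c, b] north (EuclideanSpace.single 1 ζ) =
      ((1 / √(2 * π) : ℝ) : ℂ) * (1 + a) ^ (-(1 / 2) : ℂ) *
        Complex.exp ((b - c ^ 2 / (1 + a)) * ζ ^ 2 / 2) * Complex.exp (-(‖ζ‖ : ℂ) ^ 2 / 2) := by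
  have ha0 : 1 + a ≠ 0 := by
    intro h
    simp [h] at ha
  have hexponent (s : ℝ) :
      gaussianExponent !![a, c; c, b] ((Complex.I * s) • north.1 + EuclideanSpace.single 1 ζ) =
        -((1 + a) / 2) * s ^ 2 + Complex.I * c * ζ * s + (b * ζ ^ 2 - (‖ζ‖ : ℂ) ^ 2) / 2 := by
    simp only [gaussianExponent_two, north, PiLp.add_apply, PiLp.smul_apply, PiLp.single_apply]
    simp [mul_pow]
    ring
  have hprefactor : (1 / (2 * π) * √(2 * π) : ℂ) = (1 / √(2 * π) : ℝ) := by
    rw [← Real.sqrt_div_self']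
    push_cast
    ring
  rw [gaussianSymbol_eq_integral_exp _ _ (by simp [inner_north])]
  simp only [hexponent]
  rw [integral_cexp_quadratic_of_re_pos ha, ← mul_assoc, ← mul_assoc, hprefactor,
    mul_assoc _ (Complex.exp _), ← Complex.exp_add]
  congr 2
  field_simp
  rw [Complex.I_sq]
  ring

theorem gaussianSymbol_north_eq_mul {a b c : ℂ} (ha : 0 < (1 + a).re)
    {η : EuclideanSpace ℂ (Fin 2)} (hη : inner ℂ north.1 η = 0) :
    gaussianSymbol !![a, c; c, b] north η = (1 + a) ^ (-(1 / 2) : ℂ) *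
      gaussianSymbol !![0, 0; 0, b - c ^ 2 / (1 + a)] north η := by
  obtain ⟨ζ, rfl⟩ : ∃ ζ, η = EuclideanSpace.single 1 ζ := by
    refine ⟨η 1, ?_⟩
    ext i
    fin_cases i
    · simpa [inner_north] using hη
    · simp
  rw [gaussianSymbol_north_single ha, gaussianSymbol_north_single (by simp)]
  simp
  ring

end Symbol

section Expansion

theorem integral_exp_int_mul_I (n : ℤ) :
    ∫ t in (0 : ℝ)..2 * π, Complex.exp (n * (Complex.I * t)) =
      if n = 0 then 2 * (π : ℂ) else 0 := by
  split_ifs with hn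
  · simp [hn]
  · have hperiod : Complex.exp (n * Complex.I * (2 * π : ℝ)) = 1 := by
      rw [← Complex.exp_int_mul_two_pi_mul_I n]
      push_cast
      ring_nf
    simp only [← mul_assoc]
    rw [integral_exp_mul_complex (by simp [hn]), hperiod]
    simp

theorem hasSum_circle_mean {ι : Type*} [Countable ι] {c : ι → ℂ} (hc : Summable fun i => ‖c i‖)
    (d : ι → ℕ) {f : ℝ → ℂ}
    (hf : ∀ t : ℝ, HasSum (fun i => c i * Complex.exp (Complex.I * t) ^ d i) (f t)) (k : ℕ) :
    HasSum (fun i => if d i = k then c i else 0)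
      (1 / (2 * π) * ∫ t in (0 : ℝ)..2 * π, Complex.exp (-(Complex.I * k * t)) * f t) := by
  have hterm (i : ι) (t : ℝ) :
      Complex.exp (-(Complex.I * k * t)) * (c i * Complex.exp (Complex.I * t) ^ d i) =
        c i * Complex.exp ((d i - k : ℤ) * (Complex.I * t)) := by
    rw [mul_left_comm, ← Complex.exp_nat_mul, ← Complex.exp_add]
    push_cast
    ring_nf
  have hnorm (i : ι) (t : ℝ) :
      ‖Complex.exp (-(Complex.I * k * t)) * (c i * Complex.exp (Complex.I * t) ^ d i)‖ = ‖c i‖ := by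
    rw [hterm, norm_mul, mul_left_comm, ← Complex.ofReal_intCast, ← Complex.ofReal_mul,
      Complex.norm_exp_I_mul_ofReal, mul_one]
  have hmean (i : ι) : 1 / (2 * π) * ∫ t in (0 : ℝ)..2 * π,
      Complex.exp (-(Complex.I * k * t)) * (c i * Complex.exp (Complex.I * t) ^ d i) =
        if d i = k then c i else 0 := by
    simp only [hterm, intervalIntegral.integral_const_mul, integral_exp_int_mul_I, sub_eq_zero,
      Nat.cast_inj, mul_ite, mul_zero]
    congr 1
    field_simp
  simp only [← hmean]
  refine HasSum.mul_left _ <| intervalIntegral.hasSum_integral_of_dominated_convergence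
    (fun i _ => ‖c i‖) (fun i => Continuous.aestronglyMeasurable (by fun_prop))
    (fun i => .of_forall fun t _ => (hnorm i t).le) (.of_forall fun _ _ => hc)
    intervalIntegrable_const (.of_forall fun t _ => (hf t).mul_left _)

theorem summable_norm_exp_coeff_mul (x y : ℂ) :
    Summable fun p : ℕ × ℕ => ‖x ^ p.1 / p.1.factorial * (y ^ p.2 / p.2.factorial)‖ := by
  simpa only using (NormedSpace.norm_expSeries_div_summable x).mul_norm
    (NormedSpace.norm_expSeries_div_summable y)

theorem hasSum_exp_mul_exp (x y : ℂ) :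
    HasSum (fun p : ℕ × ℕ => x ^ p.1 / p.1.factorial * (y ^ p.2 / p.2.factorial))
      (Complex.exp x * Complex.exp y) := by
  have hexp (x : ℂ) : HasSum (fun n : ℕ => x ^ n / n.factorial) (Complex.exp x) := by
    rw [Complex.exp_eq_exp_ℂ]
    exact NormedSpace.expSeries_div_hasSum_exp x
  simpa only using (hexp x).mul (hexp y) (summable_norm_exp_coeff_mul x y).of_norm

theorem circle_mean_exp_mul_exp (k : ℕ) (α β : ℂ) :
    1 / (2 * π) * ∫ t in (0 : ℝ)..2 * π, Complex.exp (-(Complex.I * k * t)) *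
      (Complex.exp (α * Complex.exp (Complex.I * t) ^ 2) *
        Complex.exp (β * Complex.exp (Complex.I * t))) =
      ∑ l ∈ Finset.range (k / 2 + 1),
        α ^ l / l.factorial * (β ^ (k - 2 * l) / (k - 2 * l).factorial) := by
  set c : ℕ × ℕ → ℂ := fun p => α ^ p.1 / p.1.factorial * (β ^ p.2 / p.2.factorial)
  have hterm (τ : ℂ) (p : ℕ × ℕ) : (α * τ ^ 2) ^ p.1 / p.1.factorial *
      ((β * τ) ^ p.2 / p.2.factorial) = c p * τ ^ (2 * p.1 + p.2) := by
    simp only [c, mul_pow, pow_add, pow_mul]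
    ring
  have hmean := hasSum_circle_mean (summable_norm_exp_coeff_mul α β) (fun p => 2 * p.1 + p.2)
    (fun t => (hasSum_exp_mul_exp (α * Complex.exp (Complex.I * t) ^ 2)
      (β * Complex.exp (Complex.I * t))).congr_fun (fun p => (hterm _ p).symm)) k
  have hinj : Set.InjOn (fun l : ℕ => (l, k - 2 * l)) (Finset.range (k / 2 + 1)) :=
    fun _ _ _ _ h => congrArg Prod.fst h
  have hfinite : HasSum (fun p : ℕ × ℕ => if 2 * p.1 + p.2 = k then c p else 0)
      (∑ p ∈ (Finset.range (k / 2 + 1)).image fun l => (l, k - 2 * l),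
        if 2 * p.1 + p.2 = k then c p else 0) := by
    refine hasSum_sum_of_ne_finset_zero fun p hp => if_neg fun h => hp ?_
    exact Finset.mem_image.mpr ⟨p.1, Finset.mem_range.mpr (by omega), Prod.ext rfl (by grind)⟩
  rw [hmean.unique hfinite, Finset.sum_image hinj]
  refine Finset.sum_congr rfl fun l hl => if_pos ?_
  grind

theorem reducedState_diagonal_north (k : ℕ) (μ : ℂ) (z : USphere 2) :
    reducedState k !![0, 0; 0, μ] north z = Complex.exp (-k) *
      ∑ l ∈ Finset.range (k / 2 + 1), (k * μ * z.1 1 ^ 2 / 2) ^ l / l.factorial *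
        ((k * z.1 0) ^ (k - 2 * l) / (k - 2 * l).factorial) := by
  rw [← circle_mean_exp_mul_exp, mul_left_comm, ← intervalIntegral.integral_const_mul, reducedState,
    reduction]
  congr 2 with t
  have hz : ‖Complex.exp (Complex.I * t) • z.1‖ = 1 := by
    rw [norm_smul, Complex.norm_exp_I_mul_ofReal, one_mul, norm_eq_of_mem_sphere]
  rw [gaussianState, hz, norm_eq_of_mem_sphere, mul_left_comm (Complex.exp (-k))]
  simp only [← Complex.exp_add]
  congr 2
  simp [quadForm, Fin.sum_univ_two, north]
  ring

theorem sqrt_factorial_mul_sqrt_choose {k l : ℕ} (hl : 2 * l ≤ k) :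
    π * √(2 / (k + 1).factorial) * ((1 / √(k - 2 * l).factorial) * √((2 * l).choose l) *
      (1 / π * √((k + 1) / 2) * √(k.choose (k - 2 * l)))) =
      1 / (l.factorial * (k - 2 * l).factorial) := by
  have hsq : 2 / ((k + 1).factorial : ℝ) * (1 / (k - 2 * l).factorial) * (2 * l).choose l *
      ((k + 1) / 2) * k.choose (k - 2 * l) = (1 / (l.factorial * (k - 2 * l).factorial)) ^ 2 := by
    rw [Nat.cast_choose ℝ (by lia : l ≤ 2 * l), Nat.cast_choose ℝ (by lia : k - 2 * l ≤ k),
      Nat.sub_sub_self hl, (by lia : 2 * l - l = l), Nat.factorial_succ]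
    push_cast
    field_simp
  have hsqrt := congrArg Real.sqrt hsq
  rw [Real.sqrt_sq (by positivity), Real.sqrt_mul (by positivity), Real.sqrt_mul (by positivity),
    Real.sqrt_mul (by positivity), Real.sqrt_mul (by positivity), Real.sqrt_div zero_le_one,
    Real.sqrt_one] at hsqrt
  rw [← hsqrt]
  field_simp

theorem reducedState_diagonal_north_eq_sum_ket (μ : ℂ) {k : ℕ} (hk : 1 ≤ k) (z : USphere 2) :
    reducedState k !![0, 0; 0, μ] north z =
      ((π * (k : ℝ) ^ k * Real.exp (-(k : ℝ)) * √(2 / (((k + 1).factorial : ℕ) : ℝ)) : ℝ) : ℂ) *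
        ∑ l ∈ Finset.range (k / 2 + 1), (1 / (2 * (k : ℂ))) ^ l *
          ((1 / √(((k - 2 * l).factorial : ℕ) : ℝ) : ℝ) : ℂ) *
          ((√(((2 * l).choose l : ℕ) : ℝ) : ℝ) : ℂ) * μ ^ l * ket k (k - 2 * l) z := by
  rw [reducedState_diagonal_north, Finset.mul_sum, Finset.mul_sum]
  refine Finset.sum_congr rfl fun l hl => ?_
  have hlk : 2 * l ≤ k := by grind
  have hk0 : (k : ℂ) ≠ 0 := by exact_mod_cast (by lia : k ≠ 0)
  have hpow : (k : ℂ) ^ k = k ^ (k - 2 * l) * k ^ (2 * l) := by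
    rw [← pow_add, Nat.sub_add_cancel hlk]
  have hcoeff := congrArg Complex.ofReal (sqrt_factorial_mul_sqrt_choose hlk)
  calc Complex.exp (-k) * ((k * μ * z.1 1 ^ 2 / 2) ^ l / l.factorial *
        ((k * z.1 0) ^ (k - 2 * l) / (k - 2 * l).factorial))
      = (k : ℂ) ^ k * Complex.exp (-k) * ((1 / (2 * (k : ℂ))) ^ l * μ ^ l *
          z.1 0 ^ (k - 2 * l) * z.1 1 ^ (2 * l)) *
          ((1 / (l.factorial * (k - 2 * l).factorial) : ℝ) : ℂ) := by
        rw [hpow]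
        push_cast
        simp only [mul_pow, div_pow, one_pow, pow_mul]
        field_simp
        ring
    _ = _ := by
        rw [← hcoeff, ket, Nat.sub_sub_self hlk]
        push_cast
        ring

end Expansion

section LowerBound

theorem mul_norm_le_norm_sum_range_succ {E : Type*} [NormedAddCommGroup E] {f : ℕ → E} {q : ℝ}
    (hq₀ : 0 ≤ q) (hq₁ : q < 1) {n : ℕ} (hf : ∀ l ≤ n, ‖f l‖ ≤ ‖f 0‖ * q ^ l) :
    (1 - q / (1 - q)) * ‖f 0‖ ≤ ‖∑ l ∈ Finset.range (n + 1), f l‖ := by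
  have hgeom : ∑ l ∈ Finset.range n, q ^ l ≤ (1 - q)⁻¹ := by
    rw [← tsum_geometric_of_lt_one hq₀ hq₁]
    exact (summable_geometric_of_lt_one hq₀ hq₁).sum_le_tsum _ fun l _ => by positivity
  have htail : ‖∑ l ∈ Finset.range n, f (l + 1)‖ ≤ q / (1 - q) * ‖f 0‖ := by
    calc ‖∑ l ∈ Finset.range n, f (l + 1)‖
        ≤ ∑ l ∈ Finset.range n, ‖f 0‖ * q ^ (l + 1) :=
          norm_sum_le_of_le _ fun l hl => hf _ (Finset.mem_range.mp hl)
      _ = ‖f 0‖ * q * ∑ l ∈ Finset.range n, q ^ l := by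
          simp only [Finset.mul_sum, pow_succ', mul_assoc]
      _ ≤ ‖f 0‖ * q * (1 - q)⁻¹ := by gcongr
      _ = q / (1 - q) * ‖f 0‖ := by ring
  rw [Finset.sum_range_succ', add_comm]
  have := norm_sub_le_norm_add (f 0) (∑ l ∈ Finset.range n, f (l + 1))
  linarith

theorem one_div_le_exp_neg_mul_pow_div_factorial {k : ℕ} (hk : 1 ≤ k) :
    1 / (Real.exp 1 * √k) ≤ Real.exp (-k) * (k ^ k / k.factorial) := by
  have hstirling : Stirling.stirlingSeq k ≤ Stirling.stirlingSeq 1 := by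
    simpa [Nat.sub_add_cancel hk] using Stirling.stirlingSeq'_antitone (Nat.zero_le (k - 1))
  rw [Stirling.stirlingSeq_one, Stirling.stirlingSeq, Real.sqrt_mul zero_le_two, div_pow,
    Real.exp_one_pow] at hstirling
  rw [Real.exp_neg, div_le_iff₀ (by positivity)]
  have : (0 : ℝ) < k := mod_cast hk
  field_simp at hstirling ⊢
  linarith

theorem one_div_factorial_sub_le {k m : ℕ} (hm : m ≤ k) :
    1 / ((k - m).factorial : ℝ) ≤ k ^ m / k.factorial := by
  rw [div_le_div_iff₀ (by positivity) (by positivity), one_mul, mul_comm]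
  have : k.factorial ≤ (k - m).factorial * k ^ m := by
    rw [← Nat.factorial_mul_descFactorial hm]
    gcongr
    exact Nat.descFactorial_le_pow k m
  exact_mod_cast this

theorem norm_expansion_term_le {μ x y : ℂ} (hμ : ‖μ‖ ≤ 1) {k l : ℕ} (hl : 2 * l ≤ k)
    (hx : 1 / 2 ≤ ‖x‖ ^ 2) (hy : k * ‖y‖ ^ 2 ≤ 1 / 4) :
    ‖(k * μ * y ^ 2 / 2) ^ l / l.factorial * ((k * x) ^ (k - 2 * l) / (k - 2 * l).factorial)‖ ≤
      (k * ‖x‖) ^ k / k.factorial * (1 / 4) ^ l := by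
  have hbase : k * ‖μ‖ * ‖y‖ ^ 2 / 2 ≤ 1 / 4 * ‖x‖ ^ 2 := by
    have : ‖μ‖ * (k * ‖y‖ ^ 2) ≤ 1 * (1 / 4) := by gcongr
    linarith
  calc ‖(k * μ * y ^ 2 / 2) ^ l / l.factorial * ((k * x) ^ (k - 2 * l) / (k - 2 * l).factorial)‖
      = (k * ‖μ‖ * ‖y‖ ^ 2 / 2) ^ l / l.factorial *
          ((k * ‖x‖) ^ (k - 2 * l) * (1 / (k - 2 * l).factorial)) := by
        simp only [norm_mul, norm_div, norm_pow, Complex.norm_natCast, Complex.norm_ofNat,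
          mul_one_div]
    _ ≤ (1 / 4 * ‖x‖ ^ 2) ^ l *
          ((k * ‖x‖) ^ (k - 2 * l) * ((k : ℝ) ^ (2 * l) / k.factorial)) := by
        have hfactorial : (1 : ℝ) ≤ l.factorial := mod_cast l.factorial_pos
        have hinv := one_div_factorial_sub_le hl
        gcongr
        exact (div_le_self (by positivity) hfactorial).trans (by gcongr)
    _ = (k * ‖x‖) ^ (k - 2 * l + 2 * l) / k.factorial * (1 / 4) ^ l := by
        rw [pow_add, pow_mul (k * ‖x‖), mul_pow (k : ℝ) ‖x‖ 2, pow_mul (k : ℝ)]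
        simp only [mul_pow]
        ring
    _ = (k * ‖x‖) ^ k / k.factorial * (1 / 4) ^ l := by rw [Nat.sub_add_cancel hl]

theorem three_quarters_le_norm_pow {x y : ℂ} {k : ℕ} (hxy : ‖x‖ ^ 2 + ‖y‖ ^ 2 = 1)
    (hy : k * ‖y‖ ^ 2 ≤ 1 / 4) : 3 / 4 ≤ ‖x‖ ^ k := by
  have hx : ‖x‖ ≤ 1 := by nlinarith [sq_nonneg ‖y‖]
  have hbernoulli := one_add_mul_le_pow (a := -‖y‖ ^ 2) (by nlinarith [sq_nonneg ‖x‖]) k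
  calc (3 : ℝ) / 4 ≤ (1 + -‖y‖ ^ 2) ^ k := by linarith
    _ = (‖x‖ ^ k) ^ 2 := by
        rw [← sub_eq_add_neg, ← hxy, add_sub_cancel_right, pow_right_comm]
    _ ≤ ‖x‖ ^ k := pow_le_of_le_one (by positivity) (pow_le_one₀ (norm_nonneg x) hx) two_ne_zero

theorem norm_sq_apply_add_norm_sq_apply (z : USphere 2) : ‖z.1 0‖ ^ 2 + ‖z.1 1‖ ^ 2 = 1 := by
  rw [← Fin.sum_univ_two fun i => ‖z.1 i‖ ^ 2, ← EuclideanSpace.norm_sq_eq,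
    norm_eq_of_mem_sphere, one_pow]

theorem le_norm_reducedState_diagonal_north {μ : ℂ} (hμ : ‖μ‖ ≤ 1) {k : ℕ} (hk : 1 ≤ k)
    {z : USphere 2} (hz : k * ‖z.1 1‖ ^ 2 ≤ 1 / 4) :
    1 / (2 * Real.exp 1 * √k) ≤ ‖reducedState k !![0, 0; 0, μ] north z‖ := by
  have hsphere := norm_sq_apply_add_norm_sq_apply z
  have hk1 : (1 : ℝ) ≤ k := mod_cast hk
  have hx : 1 / 2 ≤ ‖z.1 0‖ ^ 2 := by nlinarith [sq_nonneg ‖z.1 1‖]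
  have hsum := mul_norm_le_norm_sum_range_succ (q := 1 / 4) (n := k / 2)
    (f := fun l => (k * μ * z.1 1 ^ 2 / 2) ^ l / l.factorial *
      ((k * z.1 0) ^ (k - 2 * l) / (k - 2 * l).factorial)) (by norm_num) (by norm_num)
    (fun l hl => (norm_expansion_term_le hμ (by lia) hx hz).trans_eq (by simp))
  have hpow := three_quarters_le_norm_pow hsphere hz
  rw [reducedState_diagonal_north, norm_mul, Complex.norm_exp, Complex.neg_re, Complex.natCast_re]
  calc 1 / (2 * Real.exp 1 * √k) = 2 / 3 * (3 / 4) * (1 / (Real.exp 1 * √k)) := by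
        field_simp
        norm_num
    _ ≤ 2 / 3 * (3 / 4) * (Real.exp (-k) * (k ^ k / k.factorial)) := by
        gcongr
        exact one_div_le_exp_neg_mul_pow_div_factorial hk
    _ ≤ 2 / 3 * ‖z.1 0‖ ^ k * (Real.exp (-k) * (k ^ k / k.factorial)) := by gcongr
    _ = Real.exp (-k) * (2 / 3 * ((k * ‖z.1 0‖) ^ k / k.factorial)) := by rw [mul_pow]; ring
    _ ≤ _ := by
        gcongr
        refine le_trans (le_of_eq ?_) hsum
        simp
        norm_num

end LowerBound

section SphereMeasure

theorem lintegral_toSphere {E : Type*} [NormedAddCommGroup E] [NormedSpace ℝ E]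
    [MeasurableSpace E] [BorelSpace E] (μ : Measure E) {f : E → ENNReal} (hf : Measurable f) :
    ∫⁻ z : Metric.sphere (0 : E) 1, f z ∂μ.toSphere =
      Module.finrank ℝ E * ∫⁻ x in Metric.ball 0 1 \ {0}, f (‖x‖⁻¹ • x) ∂μ := by
  set polar : Metric.sphere (0 : E) 1 × Set.Ioi (0 : ℝ) → E :=
    Subtype.val ∘ (homeomorphUnitSphereProd E).symm
  have hpolar : MeasurableEmbedding polar :=
    (MeasurableEmbedding.subtype_coe (measurableSet_singleton _).compl).comp
      (Homeomorph.measurableEmbedding _)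
  have hnorm (p) : ‖polar p‖ = p.2 := by
    simp [polar, norm_smul, abs_of_pos (Set.mem_Ioi.mp p.2.2)]
  have hball : Set.univ ×ˢ Set.Iio ⟨1, Set.mem_Ioi.2 one_pos⟩ = polar ⁻¹' Metric.ball 0 1 := by
    ext p
    simp [hnorm, ← Subtype.coe_lt_coe]
  have hmap := hpolar.map_comap μ
  rw [Set.range_comp, (homeomorphUnitSphereProd E).symm.range_coe, Set.image_univ,
    Subtype.range_coe] at hmap
  rw [Measure.toSphere, lintegral_smul_measure, nsmul_eq_mul, Measure.fst,
    lintegral_map (f := fun z : Metric.sphere (0 : E) 1 => f z)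
      (hf.comp measurable_subtype_coe) measurable_fst,
    hball, Set.sdiff_eq, ← Measure.restrict_restrict measurableSet_ball, ← hmap,
    hpolar.restrict_map, hpolar.lintegral_map]
  congr 1
  refine lintegral_congr fun p => ?_
  rw [hnorm]
  simp [polar, smul_smul, (Set.mem_Ioi.mp p.2.2).ne']

theorem measurePreserving_apply_zero_apply_one :
    MeasurePreserving fun z : EuclideanSpace ℂ (Fin 2) => (z 0, z 1) := by
  let coords : EuclideanSpace ℂ (Fin 2) ≃ₗᵢ[ℝ] WithLp 2 (ℂ × ℂ) :=
    { toLinearEquiv := (WithLp.linearEquiv 2 ℝ (Fin 2 → ℂ)).trans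
        ((LinearEquiv.finTwoArrow ℝ ℂ).trans (WithLp.linearEquiv 2 ℝ (ℂ × ℂ)).symm)
      norm_map' := fun z => by
        simp [EuclideanSpace.norm_eq, WithLp.prod_norm_eq_of_L2] }
  exact (WithLp.volume_preserving_ofLp ℂ ℂ).comp coords.measurePreserving

theorem lintegral_exp_neg_mul_norm_sq {κ : ℝ} (hκ : 0 < κ) :
    ∫⁻ y : ℂ, ENNReal.ofReal (Real.exp (-κ * ‖y‖ ^ 2)) = ENNReal.ofReal (π / κ) := by
  have h : ∫ y : ℂ, Real.exp (-κ * ‖y‖ ^ 2) = π / κ := by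
    simpa [Complex.finrank_real_complex] using
      GaussianFourier.integral_rexp_neg_mul_sq_norm (V := ℂ) hκ
  rw [← h, ofReal_integral_eq_lintegral_ofReal
    (.of_integral_ne_zero (h ▸ by positivity)) (.of_forall fun _ => by positivity)]

theorem lintegral_surface_two {f : EuclideanSpace ℂ (Fin 2) → ENNReal} (hf : Measurable f) :
    ∫⁻ z : USphere 2, f z ∂surface 2 = 4 * ∫⁻ x in Metric.ball 0 1 \ {0}, f (‖x‖⁻¹ • x) := by
  rw [surface, lintegral_toSphere _ hf, ← Module.finrank_mul_finrank ℝ ℂ,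
    Complex.finrank_real_complex, finrank_euclideanSpace_fin]
  norm_num

theorem setLIntegral_apply_one {s : Set ℂ} (hs : MeasurableSet s) {g : ℂ → ENNReal}
    (hg : Measurable g) :
    ∫⁻ x : EuclideanSpace ℂ (Fin 2) in {x | x 0 ∈ s}, g (x 1) = volume s * ∫⁻ y, g y := by
  calc ∫⁻ x : EuclideanSpace ℂ (Fin 2) in {x | x 0 ∈ s}, g (x 1)
      = ∫⁻ p : ℂ × ℂ in s ×ˢ Set.univ, g p.2 := by
        simpa [Set.preimage] using
          measurePreserving_apply_zero_apply_one.setLIntegral_comp_preimage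
            (hs.prod .univ) (hg.comp measurable_snd)
    _ = volume s * ∫⁻ y, g y := by
        rw [Measure.volume_eq_prod, ← Measure.prod_restrict, Measure.restrict_univ]
        simpa using lintegral_prod_mul (f := fun _ : ℂ => 1) (μ := volume.restrict s)
          aemeasurable_const hg.aemeasurable

theorem lintegral_surface_exp_neg_mul_norm_sq_le {κ : ℝ} (hκ : 0 < κ) :
    ∫⁻ z : USphere 2, ENNReal.ofReal (Real.exp (-κ * ‖z.1 1‖ ^ 2)) ∂surface 2 ≤
      ENNReal.ofReal (4 * π ^ 2 / κ) := by
  rw [lintegral_surface_two (f := fun x => ENNReal.ofReal (Real.exp (-κ * ‖x 1‖ ^ 2)))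
    (by fun_prop)]
  calc 4 * ∫⁻ x : EuclideanSpace ℂ (Fin 2) in Metric.ball 0 1 \ {0},
          ENNReal.ofReal (Real.exp (-κ * ‖(‖x‖⁻¹ • x) 1‖ ^ 2))
      ≤ 4 * ∫⁻ x : EuclideanSpace ℂ (Fin 2) in {x | x 0 ∈ Metric.ball 0 1},
          ENNReal.ofReal (Real.exp (-κ * ‖x 1‖ ^ 2)) := by
        gcongr 4 * ?_
        refine (setLIntegral_mono' (measurableSet_ball.diff (measurableSet_singleton 0))
          fun x hx => ?_).trans (lintegral_mono_set fun x hx => ?_)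
        · have hx₁ : ‖x‖ ≤ 1 := (mem_ball_zero_iff.mp hx.1).le
          have hx₀ : 0 < ‖x‖ := norm_pos_iff.mpr hx.2
          have hle : ‖x 1‖ ≤ ‖(‖x‖⁻¹ • x) 1‖ := by
            rw [PiLp.smul_apply, norm_smul, norm_inv, norm_norm]
            exact le_mul_of_one_le_left (norm_nonneg _) ((one_le_inv₀ hx₀).mpr hx₁)
          simp only [neg_mul]
          gcongr
        · exact mem_ball_zero_iff.mpr
            ((PiLp.norm_apply_le x 0).trans_lt (mem_ball_zero_iff.mp hx.1))
    _ = 4 * (volume (Metric.ball (0 : ℂ) 1) *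
          ∫⁻ y : ℂ, ENNReal.ofReal (Real.exp (-κ * ‖y‖ ^ 2))) := by
        rw [setLIntegral_apply_one measurableSet_ball
          (g := fun y => ENNReal.ofReal (Real.exp (-κ * ‖y‖ ^ 2))) (by fun_prop)]
    _ = ENNReal.ofReal 4 * (ENNReal.ofReal π * ENNReal.ofReal (π / κ)) := by
        rw [lintegral_exp_neg_mul_norm_sq hκ, Complex.volume_ball]
        simp [← NNReal.coe_real_pi]
    _ = ENNReal.ofReal (4 * π ^ 2 / κ) := by
        rw [← ENNReal.ofReal_mul Real.pi_nonneg, ← ENNReal.ofReal_mul zero_le_four]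
        ring_nf

theorem volume_ball_prod_ball (u v : ℂ) {p q : ℝ} (hp : 0 ≤ p) (hq : 0 ≤ q) :
    volume {x : EuclideanSpace ℂ (Fin 2) | x 0 ∈ Metric.ball u p ∧ x 1 ∈ Metric.ball v q} =
      ENNReal.ofReal (π ^ 2 * p ^ 2 * q ^ 2) := by
  calc volume {x : EuclideanSpace ℂ (Fin 2) | x 0 ∈ Metric.ball u p ∧ x 1 ∈ Metric.ball v q}
      = volume (Metric.ball u p ×ˢ Metric.ball v q) :=
        measurePreserving_apply_zero_apply_one.measure_preimage
          (measurableSet_ball.prod measurableSet_ball).nullMeasurableSet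
    _ = ENNReal.ofReal p ^ 2 * ENNReal.ofReal π * (ENNReal.ofReal q ^ 2 * ENNReal.ofReal π) := by
        rw [Measure.volume_eq_prod, Measure.prod_prod, Complex.volume_ball, Complex.volume_ball]
        simp [← NNReal.coe_real_pi]
    _ = ENNReal.ofReal (π ^ 2 * p ^ 2 * q ^ 2) := by
        simp only [← ENNReal.ofReal_pow hp, ← ENNReal.ofReal_pow hq]
        rw [← ENNReal.ofReal_mul (by positivity), ← ENNReal.ofReal_mul (by positivity),
          ← ENNReal.ofReal_mul (by positivity)]
        ring_nf

open scoped Pointwise in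
theorem ball_prod_ball_subset_Ioo_smul {r : ℝ} (hr : r ≤ 1) :
    {x : EuclideanSpace ℂ (Fin 2) |
      x 0 ∈ Metric.ball (1 / 2 : ℂ) (1 / 4) ∧ x 1 ∈ Metric.ball 0 (r / 4)} ⊆
      Set.Ioo (0 : ℝ) 1 • (Subtype.val '' {z : USphere 2 | ‖z.1 1‖ ≤ r}) := by
  rintro x ⟨h₀, h₁⟩
  rw [mem_ball_zero_iff] at h₁
  rw [mem_ball_iff_norm] at h₀
  obtain ⟨hlow, hup⟩ : 1 / 4 ≤ ‖x 0‖ ∧ ‖x 0‖ ≤ 3 / 4 := by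
    have hdist := (abs_norm_sub_norm_le (x 0) (1 / 2)).trans h₀.le
    rw [show ‖(1 / 2 : ℂ)‖ = 1 / 2 by norm_num, abs_le] at hdist
    constructor <;> linarith
  have hx₀ : 1 / 4 ≤ ‖x‖ := hlow.trans (PiLp.norm_apply_le x 0)
  have hx₁ : ‖x‖ < 1 := by
    rw [← sq_lt_one_iff₀ (norm_nonneg x), EuclideanSpace.norm_sq_eq, Fin.sum_univ_two]
    nlinarith [norm_nonneg (x 0), norm_nonneg (x 1)]
  have hpos : 0 < ‖x‖ := by linarith
  refine ⟨‖x‖, ⟨hpos, hx₁⟩, ‖x‖⁻¹ • x,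
    ⟨⟨‖x‖⁻¹ • x, by simp [norm_smul, hpos.ne']⟩, ?_, rfl⟩, smul_inv_smul₀ hpos.ne' x⟩
  suffices ‖x‖⁻¹ * ‖x 1‖ ≤ r by simpa [norm_smul] using this
  rw [inv_mul_le_iff₀ hpos]
  nlinarith [norm_nonneg (x 1)]

theorem le_surface_setOf_norm_apply_one_le {r : ℝ} (hr₀ : 0 ≤ r) (hr₁ : r ≤ 1) :
    ENNReal.ofReal (π ^ 2 / 256 * r ^ 2) ≤ surface 2 {z : USphere 2 | ‖z.1 1‖ ≤ r} := by
  have hvol := volume_ball_prod_ball (1 / 2) 0 (by norm_num : (0 : ℝ) ≤ 1 / 4)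
    (by positivity : 0 ≤ r / 4)
  calc ENNReal.ofReal (π ^ 2 / 256 * r ^ 2) = 1 * volume {x : EuclideanSpace ℂ (Fin 2) |
        x 0 ∈ Metric.ball (1 / 2 : ℂ) (1 / 4) ∧ x 1 ∈ Metric.ball 0 (r / 4)} := by
        rw [hvol]
        ring_nf
    _ ≤ surface 2 {z : USphere 2 | ‖z.1 1‖ ≤ r} := by
        rw [surface, Measure.toSphere_apply' _
          (isClosed_le (by fun_prop) continuous_const).measurableSet]
        gcongr
        · exact_mod_cast Module.finrank_pos (R := ℝ) (M := EuclideanSpace ℂ (Fin 2))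
        · exact ball_prod_ball_subset_Ioo_smul hr₁

end SphereMeasure

section L2

theorem eLpNorm_two_sq {α E : Type*} [MeasurableSpace α] [NormedAddCommGroup E] (μ : Measure α)
    (f : α → E) : eLpNorm f 2 μ ^ 2 = ∫⁻ x, ENNReal.ofReal (‖f x‖ ^ 2) ∂μ := by
  simpa [ENNReal.ofReal_pow] using
    eLpNorm_nnreal_pow_eq_lintegral (f := f) (μ := μ) (p := 2) two_ne_zero

theorem eLpNorm_surface_le {f : USphere 2 → ℂ} {M κ : ℝ} (hM : 0 ≤ M) (hκ : 0 < κ)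
    (hf : ∀ z, ‖f z‖ ≤ M * Real.exp (-κ * ‖z.1 1‖ ^ 2)) :
    eLpNorm f 2 (surface 2) ≤ ENNReal.ofReal (M * (π * √(2 / κ))) := by
  rw [← ENNReal.pow_le_pow_left_iff two_ne_zero, eLpNorm_two_sq]
  calc ∫⁻ z, ENNReal.ofReal (‖f z‖ ^ 2) ∂surface 2
      ≤ ∫⁻ z : USphere 2, ENNReal.ofReal (M ^ 2) *
          ENNReal.ofReal (Real.exp (-(2 * κ) * ‖z.1 1‖ ^ 2)) ∂surface 2 := by
        gcongr with z
        rw [← ENNReal.ofReal_mul (by positivity)]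
        gcongr
        refine (pow_le_pow_left₀ (norm_nonneg _) (hf z) 2).trans_eq ?_
        rw [mul_pow, ← Real.exp_nat_mul]
        push_cast
        ring_nf
    _ ≤ ENNReal.ofReal (M ^ 2) * ENNReal.ofReal (4 * π ^ 2 / (2 * κ)) := by
        rw [lintegral_const_mul' _ _ ENNReal.ofReal_ne_top]
        gcongr
        exact lintegral_surface_exp_neg_mul_norm_sq_le (by positivity)
    _ = ENNReal.ofReal (M * (π * √(2 / κ))) ^ 2 := by
        rw [← ENNReal.ofReal_pow (by positivity), ← ENNReal.ofReal_mul (by positivity), mul_pow,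
          mul_pow, Real.sq_sqrt (by positivity)]
        ring_nf

theorem le_eLpNorm_surface {f : USphere 2 → ℂ} {m r : ℝ} (hm : 0 ≤ m) (hr₀ : 0 ≤ r) (hr₁ : r ≤ 1)
    (hf : ∀ z : USphere 2, ‖z.1 1‖ ≤ r → m ≤ ‖f z‖) :
    ENNReal.ofReal (m * (π / 16 * r)) ≤ eLpNorm f 2 (surface 2) := by
  set cap := {z : USphere 2 | ‖z.1 1‖ ≤ r}
  calc ENNReal.ofReal (m * (π / 16 * r))
      = ENNReal.ofReal m * ENNReal.ofReal (π ^ 2 / 256 * r ^ 2) ^ (1 / 2 : ℝ) := by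
        rw [ENNReal.ofReal_rpow_of_nonneg (by positivity) (by positivity), ← Real.sqrt_eq_rpow,
          ← ENNReal.ofReal_mul hm, show π ^ 2 / 256 * r ^ 2 = (π / 16 * r) ^ 2 by ring,
          Real.sqrt_sq (by positivity)]
    _ ≤ ENNReal.ofReal m * surface 2 cap ^ (1 / 2 : ℝ) := by
        gcongr
        exact le_surface_setOf_norm_apply_one_le hr₀ hr₁
    _ = eLpNorm (cap.indicator fun _ => m) 2 (surface 2) := by
        rw [eLpNorm_indicator_const (isClosed_le (by fun_prop) continuous_const).measurableSet
          two_ne_zero ENNReal.ofNat_ne_top, Real.enorm_of_nonneg hm, ENNReal.toReal_ofNat]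
    _ ≤ eLpNorm f 2 (surface 2) := by
        refine eLpNorm_mono fun z => ?_
        by_cases hz : z ∈ cap
        · simpa [hz, abs_of_nonneg hm] using hf z hz
        · simp [hz]

theorem le_eLpNorm_reducedState_diagonal_north {μ : ℂ} (hμ : ‖μ‖ ≤ 1) {k : ℕ} (hk : 1 ≤ k) :
    ENNReal.ofReal (π / (64 * Real.exp 1 * k)) ≤
      eLpNorm (reducedState k !![0, 0; 0, μ] north) 2 (surface 2) := by
  have hk₁ : (1 : ℝ) ≤ √k := by simpa using hk
  have h := le_eLpNorm_surface (m := 1 / (2 * Real.exp 1 * √k)) (r := 1 / (2 * √k))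
    (f := reducedState k !![0, 0; 0, μ] north) (by positivity) (by positivity)
    (by rw [div_le_one (by positivity)]; linarith) fun z hz => by
      refine le_norm_reducedState_diagonal_north hμ hk ?_
      calc k * ‖z.1 1‖ ^ 2 ≤ k * (1 / (2 * √k)) ^ 2 := by gcongr
        _ = 1 / 4 := by
          field_simp
          rw [Real.sq_sqrt k.cast_nonneg]
          ring
  convert h using 2
  field_simp
  rw [Real.sq_sqrt k.cast_nonneg]
  ring

theorem exists_eLpNorm_reducedState_north_sub_le {a b c : ℂ} (h : !![a, c; c, b] ∈ Disk 2) :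
    ∃ C : ℝ, ∀ k : ℕ, 1 ≤ k →
      eLpNorm (fun z => reducedState k !![a, c; c, b] north z - (1 + a) ^ (-(1 / 2) : ℂ) *
          reducedState k !![0, 0; 0, b - c ^ 2 / (1 + a)] north z) 2 (surface 2) ≤
        ENNReal.ofReal (C / √k) *
          eLpNorm (reducedState k !![0, 0; 0, b - c ^ 2 / (1 + a)] north) 2 (surface 2) := by
  have hμ := norm_sub_div_lt_one_of_mem_disk h
  obtain ⟨C, hC, κ, hκ, hle⟩ := exists_norm_reducedState_sub_le h (diagonal_mem_disk hμ)
    fun η hη => gaussianSymbol_north_eq_mul (one_add_re_pos_of_mem_disk h) hη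
  refine ⟨64 * Real.exp 1 * C * √(2 / κ), fun k hk => ?_⟩
  have hk₀ : (0 : ℝ) < k := mod_cast hk
  calc _ ≤ ENNReal.ofReal (C / k * (π * √(2 / (κ * k)))) := by
        refine eLpNorm_surface_le (by positivity) (by positivity) fun z => ?_
        convert hle z k hk using 3
        rw [inner_north]
        linear_combination -(κ * k) * norm_sq_apply_add_norm_sq_apply z
    _ = ENNReal.ofReal (64 * Real.exp 1 * C * √(2 / κ) / √k) *
          ENNReal.ofReal (π / (64 * Real.exp 1 * k)) := by
        rw [← ENNReal.ofReal_mul (by positivity), ← div_div 2 κ, Real.sqrt_div' _ hk₀.le]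
        field_simp
    _ ≤ _ := by
        gcongr
        exact le_eLpNorm_reducedState_diagonal_north hμ.le hk

end L2

end ReducedGaussian

theorem proposition1p6_general :
    (∀ μ : ℂ, ∀ k : ℕ, 1 ≤ k → ∀ z : ReducedGaussian.USphere 2,
      ReducedGaussian.reducedState k !![0, 0; 0, μ] ReducedGaussian.north z =
        ((Real.pi * (k : ℝ) ^ k * Real.exp (-(k : ℝ)) *
            √(2 / (((k + 1).factorial : ℕ) : ℝ)) : ℝ) : ℂ) *
          ∑ l ∈ Finset.range (k / 2 + 1),
            (1 / (2 * (k : ℂ))) ^ l *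
              ((1 / √(((k - 2 * l).factorial : ℕ) : ℝ) : ℝ) : ℂ) *
              ((√(((2 * l).choose l : ℕ) : ℝ) : ℝ) : ℂ) * μ ^ l *
              ReducedGaussian.ket k (k - 2 * l) z) ∧
    (∀ a b c : ℂ, !![a, c; c, b] ∈ ReducedGaussian.Disk 2 →
      ∀ μ : ℂ, μ = b - c ^ 2 / (1 + a) →
        0 < (1 + a).re ∧ ‖μ‖ < 1 ∧
        (∀ ζ : ℂ,
          ReducedGaussian.gaussianSymbol !![a, c; c, b] ReducedGaussian.north
              (EuclideanSpace.single 1 ζ) =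
            ((1 / √(2 * Real.pi) : ℝ) : ℂ) * (1 + a) ^ (-(1 / 2) : ℂ) *
              Complex.exp (μ * ζ ^ 2 / 2) * Complex.exp (-(‖ζ‖ : ℂ) ^ 2 / 2)) ∧
        ∃ C : ℝ, ∀ k : ℕ, 1 ≤ k →
          MeasureTheory.MemLp
            (ReducedGaussian.reducedState k !![a, c; c, b] ReducedGaussian.north) 2
            (ReducedGaussian.surface 2) ∧
          MeasureTheory.MemLp
            (ReducedGaussian.reducedState k !![0, 0; 0, μ] ReducedGaussian.north) 2
            (ReducedGaussian.surface 2) ∧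
          MeasureTheory.eLpNorm
              (fun z : ReducedGaussian.USphere 2 =>
                ReducedGaussian.reducedState k !![a, c; c, b] ReducedGaussian.north z -
                  (1 + a) ^ (-(1 / 2) : ℂ) *
                    ReducedGaussian.reducedState k !![0, 0; 0, μ] ReducedGaussian.north z)
              2 (ReducedGaussian.surface 2) ≤
            ENNReal.ofReal (C / √(k : ℝ)) *
              MeasureTheory.eLpNorm
                (ReducedGaussian.reducedState k !![0, 0; 0, μ] ReducedGaussian.north) 2
                (ReducedGaussian.surface 2)) := by
  refine ⟨fun μ k hk z => ReducedGaussian.reducedState_diagonal_north_eq_sum_ket μ hk z, ?_⟩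
  rintro a b c hA _ rfl
  have hre := ReducedGaussian.one_add_re_pos_of_mem_disk hA
  obtain ⟨C, hC⟩ := ReducedGaussian.exists_eLpNorm_reducedState_north_sub_le hA
  exact ⟨hre, ReducedGaussian.norm_sub_div_lt_one_of_mem_disk hA,
    ReducedGaussian.gaussianSymbol_north_single hre, C, fun k hk =>
      ⟨ReducedGaussian.memLp_two_reducedState k _ _,
        ReducedGaussian.memLp_two_reducedState k _ _, hC k hk⟩⟩

theorem proposition1p6 :
    -- the expansion of the reduced state of `[μ] = diag(0, μ)` at `(1, 0)`
    (∀ μ : ℂ, ‖μ‖ < 1 → ∀ k : ℕ, 1 ≤ k → ∀ z : ReducedGaussian.USphere 2,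
      ReducedGaussian.reducedState k !![0, 0; 0, μ] ReducedGaussian.north z =
        ((Real.pi * (k : ℝ) ^ k * Real.exp (-(k : ℝ)) *
            √(2 / (((k + 1).factorial : ℕ) : ℝ)) : ℝ) : ℂ) *
          ∑ l ∈ Finset.range (k / 2 + 1),
            (1 / (2 * (k : ℂ))) ^ l *
              ((1 / √(((k - 2 * l).factorial : ℕ) : ℝ) : ℝ) : ℂ) *
              ((√(((2 * l).choose l : ℕ) : ℝ) : ℝ) : ℂ) * μ ^ l *
              ReducedGaussian.ket k (k - 2 * l) z) ∧
    -- the general case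
    (∀ a b c : ℂ, !![a, c; c, b] ∈ ReducedGaussian.Disk 2 →
      ∀ μ : ℂ, μ = b - c ^ 2 / (1 + a) →
        0 < (1 + a).re ∧ ‖μ‖ < 1 ∧
        -- `μ` is the parameter of the symbol
        (∀ ζ : ℂ,
          ReducedGaussian.gaussianSymbol !![a, c; c, b] ReducedGaussian.north
              (EuclideanSpace.single 1 ζ) =
            ((1 / √(2 * Real.pi) : ℝ) : ℂ) * (1 + a) ^ (-(1 / 2) : ℂ) *
              Complex.exp (μ * ζ ^ 2 / 2) * Complex.exp (-(‖ζ‖ : ℂ) ^ 2 / 2)) ∧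
        -- the two states agree, in the norm of `L²(S³)`, up to a relative error `O(k^{-1/2})`
        ∃ C : ℝ, ∀ k : ℕ, 1 ≤ k →
          MeasureTheory.MemLp
            (ReducedGaussian.reducedState k !![a, c; c, b] ReducedGaussian.north) 2
            (ReducedGaussian.surface 2) ∧
          MeasureTheory.MemLp
            (ReducedGaussian.reducedState k !![0, 0; 0, μ] ReducedGaussian.north) 2
            (ReducedGaussian.surface 2) ∧
          MeasureTheory.eLpNorm
              (fun z : ReducedGaussian.USphere 2 =>
                ReducedGaussian.reducedState k !![a, c; c, b] ReducedGaussian.north z -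
                  (1 + a) ^ (-(1 / 2) : ℂ) *
                    ReducedGaussian.reducedState k !![0, 0; 0, μ] ReducedGaussian.north z)
              2 (ReducedGaussian.surface 2) ≤
            ENNReal.ofReal (C / √(k : ℝ)) *
              MeasureTheory.eLpNorm
                (ReducedGaussian.reducedState k !![0, 0; 0, μ] ReducedGaussian.north) 2
                (ReducedGaussian.surface 2)) := by
  exact ⟨fun μ _ => proposition1p6_general.1 μ, proposition1p6_general.2⟩
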